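/- **Theorem 2 (Hardness of SPInv).** *Problems.* Three computational problems are considered; all instances are given by finite codes over $\mathbb{Q}$. - P2P: given $k\ge 0$, polynomials $p_1,\dots,p_k\in\mathbb{Q}[x_1,\dots,x_k]$, initial values $u_1(0),\dots,u_k(0)\in\mathbb{Q}$ and a target $t\in\mathbb{Q}^k$, let $u_i(n+1)=p_i(u_1(n),\dots,u_k(n))$. Decide whether there is $m\in\mathbb{N}_0$ with $u_i(m)=t_i$ for all $i$; if so, the instance is called positive. - SPInv: given an unguarded deterministic loop with polynomial updates over $\mathbb{Q}$ (one initial polynomial assignment applied to the zero vector, then one polynomial update iterated arbitrarily often), compute a finite basis of its invariant ideal, that is, the ideal of all polynomials with coefficients in $\overline{\mathbb{Q}}$ that vanish at every valuation reachable at the loop location. A basis is returned as a finite list of polynomials with coefficients in a number field $\mathbb{Q}(\alpha)\subset\overline{\mathbb{Q}}$, where $\alpha$ is given by an irreducible polynomial over $\mathbb{Q}$ (the choice of its root does not matter). - Skolem: given a linear recurrence sequence $u(n+k)=\sum_{i<k}a_iu(n+i)$ over $\mathbb{Q}$ with $k\ge 1$ and $a_0\ne 0$, decide whether $u(m)=0$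 for some $m\in\mathbb{N}_0$. A decision problem Turing-reduces to SPInv if a single oracle program decides it with every oracle that solves SPInv. *Statement.* 1. P2P Turing-reduces to SPInv. 2. For a P2P instance consider the loop over the $k+2$ variables $g,f,x_1,\dots,x_k$ with initial values $g=0$, $f=1$, $x_i=u_i(0)$ and the simultaneous update $$x_i\leftarrow p_i(x_1,\dots,x_k),\qquad f\leftarrow f\cdot\sum_{i=1}^k(x_i-t_i)^2,\qquad g\leftarrow g+1 .$$ Let $\mathcal{I}$ be its invariant ideal and let $G$ be a Gröbner basis of $\mathcal{I}$ for the lexicographic order of any total order of the variables with $g<f<x_1,\dots,x_k$. Then the instance is positive if and only if, for some $N\in\mathbb{N}_0$, $G$ contains a nonzero scalar multiple of $$P_N=f\cdot g(g-1)\cdots(g-N+1).$$ If $G$ is the reduced Gröbner basis, the instance is positive if and only if $P_N\in G$ for some $N\in\mathbb{N}_0$. 3. This gives a decision procedure: the loop is computable from the P2P instance; there is an algorithm that, given $k+2$ and any basis of the invariant ideal of such a loop, computes a Gröbner basis of it for the lexicographic order with $g<f<x_1<\dots<x_k$; and there is an algorithm that checks whether the Gröbner basis so computed contains a nonzero scalar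 multiple of some $P_N$, which is the case if and only if the instance is positive. 4. Consequently SPInv is Skolem-hard: the Skolem problem Turing-reduces to SPInv. -/

import Mathlib

open MvPolynomial

/-! ### Oracle machines and Turing reductions -/

/-- Programs for partial recursive functions on `ℕ` with one oracle. -/
inductive OracleCode : Type
  | zero : OracleCode
  | succ : OracleCode
  | left : OracleCode
  | right : OracleCode
  | oracle : OracleCode
  | pair : OracleCode → OracleCode → OracleCode
  | comp : OracleCode → OracleCode → OracleCode
  | prec : OracleCode → OracleCode → OracleCode
  | rfind : OracleCode → OracleCode

/-- The partial function computed by a program when its oracle is `O`. An oracle call on which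
`O` is undefined does not return. -/
def OracleCode.eval (O : ℕ →. ℕ) : OracleCode → ℕ →. ℕ
  | .zero => fun _ => 0
  | .succ => fun n => Part.some (n + 1)
  | .left => fun n => Part.some (Nat.unpair n).1
  | .right => fun n => Part.some (Nat.unpair n).2
  | .oracle => O
  | .pair a b => fun n => Nat.pair <$> a.eval O n <*> b.eval O n
  | .comp a b => fun n => b.eval O n >>= a.eval O
  | .prec a b => fun p =>
      let (x, n) := Nat.unpair p
      n.rec (a.eval O x) fun y IH => do
        let i ← IH
        b.eval O (Nat.pair x (Nat.pair y i))
  | .rfind a => fun x =>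
      Nat.rfind fun n => (fun m => m = 0) <$> a.eval O (Nat.pair x n)

/-- The functions computed by these programs are exactly the functions recursive in the oracle. -/
theorem OracleCode.exists_eval_iff (O f : ℕ →. ℕ) :
    (∃ c : OracleCode, c.eval O = f) ↔ Nat.RecursiveIn {O} f := by
  constructor
  · rintro ⟨c, rfl⟩
    induction c with
    | zero => exact .zero
    | succ => exact .succ
    | left => exact .left
    | right => exact .right
    | oracle => exact .oracle _ rfl
    | pair a b ha hb => exact .pair ha hb
    | comp a b ha hb => exact .comp ha hb
    | prec a b ha hb => exact .prec ha hb
    | rfind a ha => exact .rfind ha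
  · intro h
    induction h with
    | zero => exact ⟨.zero, rfl⟩
    | succ => exact ⟨.succ, rfl⟩
    | left => exact ⟨.left, rfl⟩
    | right => exact ⟨.right, rfl⟩
    | oracle g hg => exact ⟨.oracle, (Set.mem_singleton_iff.1 hg).symm⟩
    | pair _ _ ha hb =>
      obtain ⟨a, rfl⟩ := ha
      obtain ⟨b, rfl⟩ := hb
      exact ⟨.pair a b, rfl⟩
    | comp _ _ ha hb =>
      obtain ⟨a, rfl⟩ := ha
      obtain ⟨b, rfl⟩ := hb
      exact ⟨.comp a b, rfl⟩
    | prec _ _ ha hb =>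
      obtain ⟨a, rfl⟩ := ha
      obtain ⟨b, rfl⟩ := hb
      exact ⟨.prec a b, rfl⟩
    | rfind _ ha =>
      obtain ⟨a, rfl⟩ := ha
      exact ⟨.rfind a, rfl⟩

/-- `O` solves the computational problem "given `b`, compute some `y` with `R b y`". -/
def OracleSolves {β γ : Type*} [Primcodable β] [Primcodable γ] (R : β → γ → Prop)
    (O : ℕ →. ℕ) : Prop :=
  ∀ b : β, ∃ y : γ, Encodable.encode y ∈ O (Encodable.encode b) ∧ R b y

open Classical in
/-- The decision problem `P` is Turing reducible to the computational problem `R`: one program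
decides `P` (it halts on every instance, with output `1` or `0`) with any oracle that
solves `R`. -/
def TuringReduces {α β γ : Type*} [Primcodable α] [Primcodable β] [Primcodable γ]
    (P : α → Prop) (R : β → γ → Prop) : Prop :=
  ∃ c : OracleCode, ∀ O : ℕ →. ℕ, OracleSolves R O →
    ∀ a : α, (if P a then 1 else 0) ∈ c.eval O (Encodable.encode a)

/-! ### Single-path polynomial loops and their invariant ideals -/

/-- The field of algebraic numbers. -/
abbrev QBar : Type := AlgebraicClosure ℚ

/-- An unguarded deterministic polynomial loop over `n` variables: one transition `init` from the
initial location to the looping location, one self-loop `update` at the looping location. -/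
structure PolyLoop (n : ℕ) where
  init : Fin n → MvPolynomial (Fin n) ℚ
  update : Fin n → MvPolynomial (Fin n) ℚ

/-- The two locations of a loop. -/
inductive Location : Type
  | start : Location
  | loop : Location

/-- The collecting semantics: the least family of sets of valuations, indexed by the locations,
that contains the zero valuation at the start and is closed under the two transitions. -/
inductive PolyLoop.Reachable {n : ℕ} (L : PolyLoop n) : Location → (Fin n → ℚ) → Prop
  | zero : L.Reachable .start 0
  | enter {v : Fin n → ℚ} (h : L.Reachable .start v) :
      L.Reachable .loop (fun i => eval v (L.init i))
  | step {v : Fin n → ℚ} (h : L.Reachable .loop v) :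
      L.Reachable .loop (fun i => eval v (L.update i))

/-- A polynomial with algebraic coefficients is an invariant of the loop if it vanishes at all
valuations that are reachable at the looping location. -/
def PolyLoop.IsInvariant {n : ℕ} (L : PolyLoop n) (p : MvPolynomial (Fin n) QBar) : Prop :=
  ∀ v : Fin n → ℚ, L.Reachable .loop v → eval (fun i => algebraMap ℚ QBar (v i)) p = 0

/-- The ideal of all polynomial invariants of the loop. -/
def PolyLoop.invariantIdeal {n : ℕ} (L : PolyLoop n) :
    Ideal (MvPolynomial (Fin n) QBar) where
  carrier := {p | L.IsInvariant p}
  zero_mem' := fun _ _ => map_zero _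
  add_mem' := fun {p q} hp hq v hv => by rw [map_add, hp v hv, hq v hv, add_zero]
  smul_mem' := fun c p hp v hv => by rw [smul_eq_mul, map_mul, hp v hv, mul_zero]

/-! ### Point-to-point reachability and the associated loop -/

/-- A system of `k` polynomial recursive sequences, `u_i(0) = init i` and
`u_i(n+1) = p_i(u_1(n), …, u_k(n))`, together with a target vector. -/
structure P2PInstance (k : ℕ) where
  p : Fin k → MvPolynomial (Fin k) ℚ
  init : Fin k → ℚ
  target : Fin k → ℚ

/-- The vector `(u_1(n), …, u_k(n))`. -/
noncomputable def P2PInstance.seq {k : ℕ} (A : P2PInstance k) : ℕ → Fin k → ℚ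
  | 0 => A.init
  | n + 1 => fun i => eval (A.seq n) (A.p i)

/-- The target vector is reached. -/
def P2PInstance.Positive {k : ℕ} (A : P2PInstance k) : Prop :=
  ∃ m : ℕ, ∀ i, A.seq m i = A.target i

/-- Of the `k + 2` program variables, number `0` is the counter `g`. -/
def gVar (k : ℕ) : Fin (k + 2) := 0

/-- Of the `k + 2` program variables, number `1` is `f`. -/
def fVar (k : ℕ) : Fin (k + 2) := 1

/-- Of the `k + 2` program variables, number `i + 2` models the `i`-th sequence. -/
def xVar {k : ℕ} (i : Fin k) : Fin (k + 2) := i.succ.succ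

/-- The loop
`(g, f, x) ← (0, 1, u(0)); while ⋆ do (g, f, x) ← (g + 1, f * ∑ i, (x_i - t_i)^2, p(x))`
(simultaneous assignment). -/
noncomputable def P2PInstance.toLoop {k : ℕ} (A : P2PInstance k) : PolyLoop (k + 2) where
  init := Fin.cons (C 0) (Fin.cons (C 1) fun i => C (A.init i))
  update := Fin.cons (X (gVar k) + 1)
    (Fin.cons (X (fVar k) * ∑ i : Fin k, (X (xVar i) - C (A.target i)) ^ 2)
      fun i => rename xVar (A.p i))

/-- The polynomial `f * g * (g - 1) * ⋯ * (g - N + 1)`. -/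
noncomputable def hitPoly (k N : ℕ) : MvPolynomial (Fin (k + 2)) QBar :=
  X (fVar k) * ∏ j ∈ Finset.range N, (X (gVar k) - C (j : QBar))

/-! ### Gröbner bases -/

/-- The order opposite to `ord`. -/
@[reducible] def dualOrder {n : ℕ} (ord : LinearOrder (Fin n)) : LinearOrder (Fin n) :=
  @LinearOrder.lift' (Fin n) (Fin n)ᵒᵈ (@OrderDual.instLinearOrder (Fin n) ord)
    OrderDual.toDual OrderDual.toDual.injective

/-- The lexicographic monomial order in which smaller variables are larger monomials. -/
noncomputable def lexDecreasing {σ : Type*} [LinearOrder σ] [Finite σ] : MonomialOrder σ :=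
  MonomialOrder.lex

/-- The lexicographic monomial order extending the order `ord` of the variables: a variable that
is larger for `ord` is a larger monomial. -/
noncomputable def lexOrder {n : ℕ} (ord : LinearOrder (Fin n)) : MonomialOrder (Fin n) :=
  @lexDecreasing (Fin n) (dualOrder ord) _

/-- `G` is a Gröbner basis of the ideal `I` for the monomial order `m`. -/
def IsGroebnerBasis {σ K : Type*} [Field K] (m : MonomialOrder σ) (I : Ideal (MvPolynomial σ K))
    (G : Set (MvPolynomial σ K)) : Prop :=
  G.Finite ∧ Ideal.span G = I ∧
    Ideal.span (m.leadingTerm '' G) = Ideal.span (m.leadingTerm '' (I : Set (MvPolynomial σ K)))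

/-- `G` is a reduced Gröbner basis of the ideal `I` for the monomial order `m`. -/
def IsReducedGroebnerBasis {σ K : Type*} [Field K] (m : MonomialOrder σ)
    (I : Ideal (MvPolynomial σ K)) (G : Set (MvPolynomial σ K)) : Prop :=
  IsGroebnerBasis m I G ∧ (∀ g ∈ G, m.leadingCoeff g = 1) ∧
    ∀ g ∈ G, ∀ h ∈ G, g ≠ h → ∀ d ∈ g.support, ¬ m.degree h ≤ d

/-! ### Finite codes for instances and for bases -/

/-- `(a, b)` stands for the rational number `a / (b + 1)`. -/
abbrev RatCode : Type := ℤ × ℕ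

/-- `[c₀, c₁, …]` stands for the univariate polynomial `c₀ + c₁ y + ⋯`. -/
abbrev UniPolyCode : Type := List RatCode

/-- A list of terms, each given by its exponents and its coefficient. -/
abbrev PolyCode : Type := List (List ℕ × RatCode)

/-- As `PolyCode`, with a coefficient in a number field `ℚ(α)`, written as a polynomial in `α`. -/
abbrev AlgPolyCode : Type := List (List ℕ × UniPolyCode)

/-- The number of variables, and the polynomials `(init i, update i)`. -/
abbrev LoopCode : Type := ℕ × List (PolyCode × PolyCode)

/-- The number `k` of sequences, and the data `(p i, init i, target i)`. -/
abbrev P2PCode : Type := ℕ × List (PolyCode × RatCode × RatCode)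

/-- The order, and the pairs of a coefficient `a i` and an initial value `u(i)`. -/
abbrev SkolemCode : Type := ℕ × List (RatCode × RatCode)

/-- A finite set of polynomials over a number field `ℚ(α)`: an irreducible polynomial with
root `α`, and the elements of the set. -/
abbrev BasisCode : Type := UniPolyCode × List AlgPolyCode

def ratOf (q : RatCode) : ℚ := (q.1 : ℚ) / ((q.2 : ℚ) + 1)

noncomputable def uniPolyOf (c : UniPolyCode) : Polynomial ℚ :=
  ∑ i ∈ Finset.range c.length, Polynomial.C (ratOf (c.getD i (0, 0))) * Polynomial.X ^ i

/-- The exponent vector in `n` variables given by a list: missing exponents are `0`, and entries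
beyond the first `n` are ignored. -/
noncomputable def exponentOf (n : ℕ) (e : List ℕ) : Fin n →₀ ℕ :=
  Finsupp.equivFunOnFinite.symm fun i => e.getD i 0

noncomputable def polyOf (n : ℕ) (c : PolyCode) : MvPolynomial (Fin n) ℚ :=
  (c.map fun t => monomial (exponentOf n t.1) (ratOf t.2)).sum

noncomputable def algPolyOf (n : ℕ) (α : QBar) (c : AlgPolyCode) : MvPolynomial (Fin n) QBar :=
  (c.map fun t => monomial (exponentOf n t.1) (Polynomial.aeval α (uniPolyOf t.2))).sum

/-- The loop given by a code; missing entries of the list are `0`. -/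
noncomputable def loopOf (c : LoopCode) : PolyLoop c.1 where
  init := fun i => polyOf c.1 (c.2.getD i ([], [])).1
  update := fun i => polyOf c.1 (c.2.getD i ([], [])).2

/-- The instance given by a code; missing entries of the list are `0`. -/
noncomputable def p2pOf (c : P2PCode) : P2PInstance c.1 where
  p := fun i => polyOf c.1 (c.2.getD i ([], (0, 0), (0, 0))).1
  init := fun i => ratOf (c.2.getD i ([], (0, 0), (0, 0))).2.1
  target := fun i => ratOf (c.2.getD i ([], (0, 0), (0, 0))).2.2

/-- The linear recurrence `u(n + k) = ∑ i, a i * u(n + i)` given by a code. -/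
noncomputable def recurrenceOf (c : SkolemCode) : LinearRecurrence ℚ where
  order := c.1
  coeffs := fun i => ratOf (c.2.getD i ((0, 0), (0, 0))).1

/-- The linear recurrence sequence given by a code. -/
noncomputable def lrsOf (c : SkolemCode) : ℕ → ℚ :=
  (recurrenceOf c).mkSol fun i => ratOf (c.2.getD i ((0, 0), (0, 0))).2

/-- The code `B` represents the set `S` of polynomials in `n` variables with algebraic
coefficients (a code determines the set up to the choice of the root `α`). -/
def Represents (n : ℕ) (B : BasisCode) (S : Set (MvPolynomial (Fin n) QBar)) : Prop :=
  Irreducible (uniPolyOf B.1) ∧ ∃ α : QBar, Polynomial.aeval α (uniPolyOf B.1) = 0 ∧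
    S = {p | ∃ q ∈ B.2, algPolyOf n α q = p}

/-! ### The three problems -/

/-- The Skolem problem: does the given linear recurrence sequence (of order at least one, with
nonzero trailing coefficient) have a zero? -/
def Skolem (c : SkolemCode) : Prop :=
  (∃ h : 0 < c.1, (recurrenceOf c).coeffs ⟨0, h⟩ ≠ 0) ∧ ∃ m : ℕ, lrsOf c m = 0

/-- Point-to-point reachability for polynomial recursive sequences. -/
def P2P (c : P2PCode) : Prop := (p2pOf c).Positive

/-- Strongest polynomial invariant: given a loop, compute a basis of its invariant ideal. -/
def SPInv (L : LoopCode) (B : BasisCode) : Prop :=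
  ∃ S : Set (MvPolynomial (Fin L.1) QBar),
    Represents L.1 B S ∧ Ideal.span S = (loopOf L).invariantIdeal

/-! ### Oracle programs for partial recursive functions -/

/-! After `n` iterations the loop is in the state `(n, f(n), u(n))`, where `f(n)` is the product
over `j < n` of the squared distances between `u(j)` and the target. Over `ℚ` such a distance
vanishes only at a hit, and once `f` is zero it stays zero. Hence `P_N` is invariant iff `f(N) = 0`
(`hitPoly_mem_invariantIdeal_iff`), and the instance is positive iff this happens for some `N`.

To find `P_N` in a Gröbner basis, take the least `N` with `f(N) = 0`. Some basis element `h` has a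
leading monomial dividing `f g^N`. As `g < f < x_i`, no other variables occur in `h`, so `h = p(g) f
+ q(g)` with `deg p ≤ N`. Evaluation at the times `n ≥ N` gives `q = 0`; evaluation at `j < N`,
where `f(j) ≠ 0`, gives the roots `0, …, N - 1` of `p`. So `h` is a scalar multiple of `P_N`
(`P2PInstance.positive_iff_groebner`).

The Gröbner basis is computed by unbounded search for a certificate: monic polynomials together with
linear combinations that witness equality of the two ideals and the reduction of all S-polynomials.
Identities in `ℚ(α)` are checked in `ℚ[y]` up to an explicit multiple of the minimal polynomial, so
checking needs only ring operations on rationals and is primitive recursive. Buchberger's criterion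
makes certificates sound (`GroebnerCert.isGroebnerBasis`). Noetherianity, the division algorithm and
lifting from `ℚ[y]/(μ)` to `ℚ[y]` make them exist (`GroebnerCert.exists_valid`). The final test
merely looks for an element all of whose terms are products of `f` and a power of `g`
(`P2PInstance.checkBasis_iff`).

For the Skolem problem, the shift register of the recurrence is multiplied by its first entry in
each step. The vector becomes zero right after a zero of the sequence, and never without one
(`skolem_iff`). -/

theorem Nat.Partrec.exists_oracleCode {f : ℕ →. ℕ} (hf : Nat.Partrec f) :
    ∃ c : OracleCode, ∀ O : ℕ →. ℕ, c.eval O = f := by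
  induction hf with
  | zero => exact ⟨.zero, fun _ => rfl⟩
  | succ => exact ⟨.succ, fun _ => rfl⟩
  | left => exact ⟨.left, fun _ => rfl⟩
  | right => exact ⟨.right, fun _ => rfl⟩
  | pair _ _ ha hb =>
    obtain ⟨a, ha⟩ := ha
    obtain ⟨b, hb⟩ := hb
    exact ⟨.pair a b, fun O => by simp only [OracleCode.eval, ha, hb]; rfl⟩
  | comp _ _ ha hb =>
    obtain ⟨a, ha⟩ := ha
    obtain ⟨b, hb⟩ := hb
    exact ⟨.comp a b, fun O => by simp only [OracleCode.eval, ha, hb]; rfl⟩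
  | prec _ _ ha hb =>
    obtain ⟨a, ha⟩ := ha
    obtain ⟨b, hb⟩ := hb
    exact ⟨.prec a b, fun O => by simp only [OracleCode.eval, ha, hb]; rfl⟩
  | rfind _ ha =>
    obtain ⟨a, ha⟩ := ha
    exact ⟨.rfind a, fun O => by simp only [OracleCode.eval, ha]; rfl⟩

theorem Partrec.exists_oracleCode {α β : Type*} [Primcodable α] [Primcodable β] {f : α →. β}
    (hf : Partrec f) : ∃ c : OracleCode, ∀ (O : ℕ →. ℕ) (a : α) (b : β), b ∈ f a →
      Encodable.encode b ∈ c.eval O (Encodable.encode a) := by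
  obtain ⟨c, hc⟩ := Nat.Partrec.exists_oracleCode hf
  refine ⟨c, fun O a b hb => ?_⟩
  rw [hc O]
  simpa using hb

theorem OracleCode.mem_eval_pair {O : ℕ →. ℕ} {a b : OracleCode} {n x y : ℕ}
    (hx : x ∈ a.eval O n) (hy : y ∈ b.eval O n) : Nat.pair x y ∈ (OracleCode.pair a b).eval O n := by
  change _ ∈ (Nat.pair <$> (a.eval O n : Part ℕ) <*> (b.eval O n : Part ℕ))
  rw [Part.eq_some_iff.2 hx, Part.eq_some_iff.2 hy]
  simp [Seq.seq]

theorem OracleCode.mem_eval_comp {O : ℕ →. ℕ} {a b : OracleCode} {n x y : ℕ}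
    (hx : x ∈ b.eval O n) (hy : y ∈ a.eval O x) : y ∈ (OracleCode.comp a b).eval O n :=
  Part.mem_bind hx hy

open Classical in
/-- A reduction with one oracle call: construct an instance, call the oracle, and decide from the
original instance together with the answer. -/
theorem TuringReduces.of_one_call {α β γ : Type*} [Primcodable α] [Primcodable β] [Primcodable γ]
    {P : α → Prop} {R : β → γ → Prop} (mk : α → β) (hmk : Computable mk)
    (dec : α × γ →. Bool) (hdec : Partrec dec)
    (h : ∀ a y, R (mk a) y → ∃ b ∈ dec (a, y), (b = true ↔ P a)) : TuringReduces P R := by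
  obtain ⟨cm, hcm⟩ := Partrec.exists_oracleCode hmk.partrec
  obtain ⟨cd, hcd⟩ := Partrec.exists_oracleCode
    (hdec.map (g := fun _ b => cond b 1 0)
      (Computable.cond Computable.snd (Computable.const 1) (Computable.const 0)))
  -- A program for the identity, which keeps the instance available next to the oracle's answer.
  obtain ⟨ci, hci⟩ := Partrec.exists_oracleCode (f := fun n : ℕ => Part.some n) Partrec.some
  refine ⟨.comp cd (.pair ci (.comp .oracle cm)), fun O hO a => ?_⟩
  obtain ⟨y, hy, hR⟩ := hO (mk a)
  obtain ⟨b, hb, hP⟩ := h a y hR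
  have h1 : Encodable.encode (mk a) ∈ cm.eval O (Encodable.encode a) :=
    hcm O a _ (Part.mem_some _)
  have h2 : Encodable.encode a ∈ ci.eval O (Encodable.encode a) :=
    hci O (Encodable.encode a) (Encodable.encode a) (Part.mem_some _)
  have h3 : Encodable.encode (a, y) ∈
      (OracleCode.pair ci (.comp .oracle cm)).eval O (Encodable.encode a) :=
    OracleCode.mem_eval_pair h2 (OracleCode.mem_eval_comp (a := .oracle) h1 hy)
  have h4 := OracleCode.mem_eval_comp h3 (hcd O (a, y) (cond b 1 0) (Part.mem_map _ hb))
  convert! h4 using 1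
  by_cases hPa : P a
  · simp [hPa, hP.2 hPa]
  · have : b = false := by simpa [hPa] using hP
    simp [hPa, this]

/-! ### Primitive recursive arithmetic of integers and of codes of rational numbers -/

namespace Primrec

/-- An integer has the same code as its image in `ℕ ⊕ ℕ`, so case distinction on the sign becomes
available. The arithmetic of `ℤ` is then reduced to that of positive and negative parts. -/
theorem intEquivNatSumNat : Primrec Equiv.intEquivNatSumNat := by
  refine Primrec.encode_iff.1 ?_
  refine (Primrec.encode (α := ℤ)).of_eq fun z => ?_
  rcases z with n | n <;> rfl

theorem int_ofNat : Primrec (fun n : ℕ => (n : ℤ)) := by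
  refine Primrec.encode_iff.1 ?_
  exact (Primrec.encode.comp (Primrec.sumInl (α := ℕ) (β := ℕ))).of_eq fun z => rfl

theorem int_negSucc : Primrec Int.negSucc := by
  refine Primrec.encode_iff.1 ?_
  exact (Primrec.encode.comp (Primrec.sumInr (α := ℕ) (β := ℕ))).of_eq fun z => rfl

theorem int_toNat : Primrec Int.toNat := by
  refine (Primrec.sumCasesOn (f := Equiv.intEquivNatSumNat) (g := fun _ n => n)
    (h := fun _ _ => 0) intEquivNatSumNat Primrec₂.right (Primrec₂.const 0)).of_eq fun z => ?_
  rcases z with n | n <;> rfl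

theorem int_toNat_neg : Primrec (fun z : ℤ => (-z).toNat) := by
  refine (Primrec.sumCasesOn (f := Equiv.intEquivNatSumNat) (g := fun _ _ => 0)
    (h := fun _ n => n + 1) intEquivNatSumNat (Primrec₂.const 0)
    (Primrec.succ.comp Primrec.snd)).of_eq fun z => ?_
  rcases z with n | n
  · change 0 = (-(n : ℤ)).toNat
    omega
  · rfl

theorem int_subNatNat : Primrec₂ (fun m n : ℕ => (m : ℤ) - n) := by
  have h : Primrec (fun p : ℕ × ℕ => if p.2 ≤ p.1 then ((p.1 - p.2 : ℕ) : ℤ)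
      else Int.negSucc (p.2 - p.1 - 1)) :=
    Primrec.ite (Primrec.nat_le.comp Primrec.snd Primrec.fst)
      (int_ofNat.comp (Primrec.nat_sub.comp Primrec.fst Primrec.snd))
      (int_negSucc.comp (Primrec.nat_sub.comp (Primrec.nat_sub.comp Primrec.snd Primrec.fst)
        (Primrec.const 1)))
  refine h.of_eq fun p => ?_
  dsimp only
  split_ifs with hp
  · omega
  · rw [Int.negSucc_eq]; omega

theorem int_neg : Primrec (fun z : ℤ => -z) :=
  (int_subNatNat.comp int_toNat_neg int_toNat).of_eq fun z => by omega

theorem int_add : Primrec₂ (fun a b : ℤ => a + b) := by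
  have h : Primrec (fun p : ℤ × ℤ => (((p.1.toNat + p.2.toNat : ℕ) : ℤ)
      - (((-p.1).toNat + (-p.2).toNat : ℕ) : ℤ))) :=
    int_subNatNat.comp
      (Primrec.nat_add.comp (int_toNat.comp Primrec.fst) (int_toNat.comp Primrec.snd))
      (Primrec.nat_add.comp (int_toNat_neg.comp Primrec.fst) (int_toNat_neg.comp Primrec.snd))
  exact h.of_eq fun p => by dsimp only; omega

theorem int_mul : Primrec₂ (fun a b : ℤ => a * b) := by
  have pos : Primrec (fun p : ℤ × ℤ => p.1.toNat * p.2.toNat + (-p.1).toNat * (-p.2).toNat) :=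
    Primrec.nat_add.comp
      (Primrec.nat_mul.comp (int_toNat.comp Primrec.fst) (int_toNat.comp Primrec.snd))
      (Primrec.nat_mul.comp (int_toNat_neg.comp Primrec.fst) (int_toNat_neg.comp Primrec.snd))
  have neg : Primrec (fun p : ℤ × ℤ => p.1.toNat * (-p.2).toNat + (-p.1).toNat * p.2.toNat) :=
    Primrec.nat_add.comp
      (Primrec.nat_mul.comp (int_toNat.comp Primrec.fst) (int_toNat_neg.comp Primrec.snd))
      (Primrec.nat_mul.comp (int_toNat_neg.comp Primrec.fst) (int_toNat.comp Primrec.snd))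
  refine (int_subNatNat.comp pos neg).of_eq fun p => ?_
  have h (z : ℤ) : z = z.toNat - (-z).toNat := by omega
  conv_rhs => rw [h p.1, h p.2]
  push_cast
  ring

end Primrec

/-- Fractions are never brought to lowest terms, since only the value `ratOf` of a code matters. The
`- 1` compensates for the denominator being stored as its predecessor. -/
def ratAdd (p q : RatCode) : RatCode :=
  (p.1 * ((q.2 : ℤ) + 1) + q.1 * ((p.2 : ℤ) + 1), (p.2 + 1) * (q.2 + 1) - 1)

def ratMul (p q : RatCode) : RatCode := (p.1 * q.1, (p.2 + 1) * (q.2 + 1) - 1)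

def ratNeg (p : RatCode) : RatCode := (-p.1, p.2)

theorem ratOf_ratAdd (p q : RatCode) : ratOf (ratAdd p q) = ratOf p + ratOf q := by
  have h : (((p.2 + 1) * (q.2 + 1) - 1 : ℕ) : ℚ) + 1 = (p.2 + 1) * (q.2 + 1) := by
    rw [Nat.cast_sub (Nat.mul_pos (Nat.succ_pos _) (Nat.succ_pos _))]; push_cast; ring
  have hp : (p.2 : ℚ) + 1 ≠ 0 := by positivity
  have hq : (q.2 : ℚ) + 1 ≠ 0 := by positivity
  simp only [ratOf, ratAdd, h]
  field_simp
  push_cast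
  ring

theorem ratOf_ratMul (p q : RatCode) : ratOf (ratMul p q) = ratOf p * ratOf q := by
  have h : (((p.2 + 1) * (q.2 + 1) - 1 : ℕ) : ℚ) + 1 = (p.2 + 1) * (q.2 + 1) := by
    rw [Nat.cast_sub (Nat.mul_pos (Nat.succ_pos _) (Nat.succ_pos _))]; push_cast; ring
  have hp : (p.2 : ℚ) + 1 ≠ 0 := by positivity
  have hq : (q.2 : ℚ) + 1 ≠ 0 := by positivity
  simp only [ratOf, ratMul, h]
  field_simp
  push_cast
  ring

theorem ratOf_ratNeg (p : RatCode) : ratOf (ratNeg p) = -ratOf p := by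
  simp [ratOf, ratNeg, neg_div]

theorem ratOf_eq_zero_iff {p : RatCode} : ratOf p = 0 ↔ p.1 = 0 := by
  have hp : (p.2 : ℚ) + 1 ≠ 0 := by positivity
  simp [ratOf, hp]

@[simp] theorem ratOf_zero (n : ℕ) : ratOf (0, n) = 0 := by simp [ratOf]

@[simp] theorem ratOf_one : ratOf (1, 0) = 1 := by simp [ratOf]

theorem ratOf_surjective : Function.Surjective ratOf := fun q => by
  refine ⟨(q.num, q.den - 1), ?_⟩
  have h : ((q.den - 1 : ℕ) : ℚ) + 1 = q.den := by
    rw [Nat.cast_sub q.den_pos]; push_cast; ring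
  simp [ratOf, h, Rat.num_div_den]

theorem primrec_ratAdd : Primrec₂ ratAdd := by
  have hs {f : RatCode × RatCode → ℕ} (hf : Primrec f) :
      Primrec fun p => ((f p : ℤ) + 1) :=
    Primrec.int_add.comp (Primrec.int_ofNat.comp hf) (Primrec.const 1)
  have h1 : Primrec fun p : RatCode × RatCode => p.1.1 := Primrec.fst.comp Primrec.fst
  have h2 : Primrec fun p : RatCode × RatCode => p.1.2 := Primrec.snd.comp Primrec.fst
  have h3 : Primrec fun p : RatCode × RatCode => p.2.1 := Primrec.fst.comp Primrec.snd
  have h4 : Primrec fun p : RatCode × RatCode => p.2.2 := Primrec.snd.comp Primrec.snd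
  exact (Primrec.int_add.comp (Primrec.int_mul.comp h1 (hs h4))
    (Primrec.int_mul.comp h3 (hs h2))).pair
      (Primrec.nat_sub.comp (Primrec.nat_mul.comp (Primrec.succ.comp h2) (Primrec.succ.comp h4))
        (Primrec.const 1))

theorem primrec_ratMul : Primrec₂ ratMul := by
  have h2 : Primrec fun p : RatCode × RatCode => p.1.2 := Primrec.snd.comp Primrec.fst
  have h4 : Primrec fun p : RatCode × RatCode => p.2.2 := Primrec.snd.comp Primrec.snd
  exact (Primrec.int_mul.comp (Primrec.fst.comp Primrec.fst) (Primrec.fst.comp Primrec.snd)).pair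
      (Primrec.nat_sub.comp (Primrec.nat_mul.comp (Primrec.succ.comp h2) (Primrec.succ.comp h4))
        (Primrec.const 1))

theorem primrec_ratNeg : Primrec ratNeg :=
  (Primrec.int_neg.comp Primrec.fst).pair Primrec.snd

/-! ### Decidable quantifiers over computed lists -/

theorem PrimrecPred.forall_mem {α β : Type*} [Primcodable α] [Primcodable β] {f : α → List β}
    (hf : Primrec f) {R : α → β → Prop} (hR : PrimrecPred fun x : α × β => R x.1 x.2) :
    PrimrecPred fun a => ∀ b ∈ f a, R a b :=
  (PrimrecRel.forall_mem_list (PrimrecRel.swap hR)).comp hf Primrec.id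

theorem PrimrecPred.exists_mem {α β : Type*} [Primcodable α] [Primcodable β] {f : α → List β}
    (hf : Primrec f) {R : α → β → Prop} (hR : PrimrecPred fun x : α × β => R x.1 x.2) :
    PrimrecPred fun a => ∃ b ∈ f a, R a b :=
  (PrimrecRel.exists_mem_list (PrimrecRel.swap hR)).comp hf Primrec.id

/-! ### Buchberger's criterion and the existence of Gröbner bases -/

namespace MonomialOrder

variable {σ K : Type*} [Field K] (m : MonomialOrder σ)

/-- The span of the monomial multiples `x ^ a * g` of elements of `G` for which the exponent of the
leading term satisfies `P`. -/
noncomputable def multiplesSpan (G : Set (MvPolynomial σ K)) (P : (σ →₀ ℕ) → Prop) :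
    Submodule K (MvPolynomial σ K) :=
  Submodule.span K {x | ∃ a, ∃ g ∈ G, P (a + m.degree g) ∧ x = monomial a 1 * g}

variable {m} {G : Set (MvPolynomial σ K)}

theorem multiplesSpan_mono {P Q : (σ →₀ ℕ) → Prop} (h : ∀ d, P d → Q d) :
    m.multiplesSpan G P ≤ m.multiplesSpan G Q :=
  Submodule.span_mono fun _ ⟨a, g, hg, hP, hx⟩ => ⟨a, g, hg, h _ hP, hx⟩

theorem monomial_mul_mem_multiplesSpan {P : (σ →₀ ℕ) → Prop} {a : σ →₀ ℕ}
    {g : MvPolynomial σ K} (hg : g ∈ G) (h : P (a + m.degree g)) (c : K) :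
    monomial a c * g ∈ m.multiplesSpan G P := by
  have : monomial a c * g = c • (monomial a 1 * g) := by
    rw [← smul_mul_assoc, smul_monomial, smul_eq_mul, mul_one]
  rw [this]
  exact Submodule.smul_mem _ _ (Submodule.subset_span ⟨a, g, hg, h, rfl⟩)

theorem mul_mem_multiplesSpan {P : (σ →₀ ℕ) → Prop} {q g : MvPolynomial σ K} (hg : g ∈ G)
    (h : ∀ a ∈ q.support, P (a + m.degree g)) : q * g ∈ m.multiplesSpan G P := by
  rw [q.as_sum, Finset.sum_mul]
  exact Submodule.sum_mem _ fun a ha => monomial_mul_mem_multiplesSpan hg (h a ha) _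

theorem coeff_eq_zero_of_mem_multiplesSpan {P : (σ →₀ ℕ) → Prop} {h : MvPolynomial σ K}
    (hh : h ∈ m.multiplesSpan G P) {d : σ →₀ ℕ} (hd : ∀ e, P e → m.toSyn e < m.toSyn d) :
    h.coeff d = 0 := by
  induction hh using Submodule.span_induction with
  | mem x hx =>
    obtain ⟨a, g, -, hP, rfl⟩ := hx
    refine m.coeff_eq_zero_of_lt (lt_of_le_of_lt ?_ (hd _ hP))
    refine (m.degree_mul_le).trans ?_
    rw [map_add, map_add]
    gcongr
    exact m.degree_monomial_le 1
  | zero => simp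
  | add x y _ _ hx hy => rw [coeff_add, hx, hy, add_zero]
  | smul c x _ hx => rw [coeff_smul, hx, smul_zero]

theorem monomial_mul_multiplesSpan {P Q : (σ →₀ ℕ) → Prop} {h : MvPolynomial σ K}
    (hh : h ∈ m.multiplesSpan G P) (c : σ →₀ ℕ) (hPQ : ∀ d, P d → Q (c + d)) :
    monomial c 1 * h ∈ m.multiplesSpan G Q := by
  induction hh using Submodule.span_induction with
  | mem x hx =>
    obtain ⟨a, g, hg, hP, rfl⟩ := hx
    rw [← mul_assoc, monomial_mul, mul_one]
    exact monomial_mul_mem_multiplesSpan hg (by rw [add_assoc]; exact hPQ _ hP) 1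
  | zero => simp
  | add x y _ _ hx hy => rw [mul_add]; exact Submodule.add_mem _ hx hy
  | smul c x _ hx => rw [mul_smul_comm]; exact Submodule.smul_mem _ _ hx

theorem mem_multiplesSpan_of_mem_span {h : MvPolynomial σ K} (hh : h ∈ Ideal.span G) :
    h ∈ m.multiplesSpan G fun _ => True := by
  induction hh using Submodule.span_induction with
  | mem x hx => simpa using mul_mem_multiplesSpan (m := m) (q := 1) hx (fun _ _ => trivial)
  | zero => exact Submodule.zero_mem _
  | add x y _ _ hx hy => exact Submodule.add_mem _ hx hy
  | smul c x _ hx =>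
    rw [smul_eq_mul]
    induction c using MvPolynomial.induction_on' with
    | monomial a r =>
      have : monomial a r * x = r • (monomial a 1 * x) := by
        rw [← smul_mul_assoc, smul_monomial, smul_eq_mul, mul_one]
      rw [this]
      exact Submodule.smul_mem _ _ (monomial_mul_multiplesSpan hx a fun _ _ => trivial)
    | add p q hp hq => rw [add_mul]; exact Submodule.add_mem _ hp hq

/-- A member is a finite combination of multiples, and the largest leading exponent among them still
satisfies `P`. In Buchberger's criterion this turns a strict bound into a weak bound at a smaller
exponent, which is the descent step. -/
theorem exists_le_of_mem_multiplesSpan {P : (σ →₀ ℕ) → Prop} {h : MvPolynomial σ K}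
    (hh : h ∈ m.multiplesSpan G P) : h = 0 ∨ ∃ d, P d ∧
      h ∈ m.multiplesSpan G fun e => m.toSyn e ≤ m.toSyn d := by
  induction hh using Submodule.span_induction with
  | mem x hx =>
    obtain ⟨a, g, hg, hP, rfl⟩ := hx
    refine .inr ⟨a + m.degree g, hP, ?_⟩
    exact monomial_mul_mem_multiplesSpan (P := fun e => m.toSyn e ≤ m.toSyn (a + m.degree g))
      hg le_rfl 1
  | zero => exact .inl rfl
  | add x y _ _ hx hy =>
    rcases hx with rfl | ⟨d, hd, hx⟩
    · rw [zero_add]; exact hy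
    rcases hy with rfl | ⟨e, he, hy⟩
    · rw [add_zero]; exact .inr ⟨d, hd, hx⟩
    rcases le_total (m.toSyn d) (m.toSyn e) with hde | hde
    · exact .inr ⟨e, he,
        Submodule.add_mem _ (multiplesSpan_mono (fun _ h => h.trans hde) hx) hy⟩
    · exact .inr ⟨d, hd,
        Submodule.add_mem _ hx (multiplesSpan_mono (fun _ h => h.trans hde) hy)⟩
  | smul c x _ hx =>
    rcases hx with rfl | ⟨d, hd, hx⟩
    · exact .inl (smul_zero c)
    · exact .inr ⟨d, hd, Submodule.smul_mem _ _ hx⟩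

/-- Both leading exponents lie below `d`, hence so does their supremum, and the difference is the
S-polynomial times the monomial with the remaining exponent. -/
theorem monomial_mul_sub_mem_multiplesSpan
    (hG : ∀ g ∈ G, m.Monic g) (hS : ∀ p ∈ G, ∀ q ∈ G, m.sPolynomial p q ∈
      m.multiplesSpan G fun d => m.toSyn d < m.toSyn (m.degree p ⊔ m.degree q))
    {p q : MvPolynomial σ K} (hp : p ∈ G) (hq : q ∈ G) {a b d : σ →₀ ℕ}
    (ha : a + m.degree p = d) (hb : b + m.degree q = d) :
    monomial a 1 * p - monomial b 1 * q ∈ m.multiplesSpan G fun e => m.toSyn e < m.toSyn d := by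
  have hle : m.degree p ⊔ m.degree q ≤ d :=
    sup_le (ha ▸ le_add_self) (hb ▸ le_add_self)
  have key := monomial_mul_multiplesSpan (hS p hp q hq) (d - m.degree p ⊔ m.degree q)
    (Q := fun e => m.toSyn e < m.toSyn d) (fun e he => by
      have h : d - m.degree p ⊔ m.degree q + m.degree p ⊔ m.degree q = d := tsub_add_cancel_of_le hle
      conv_rhs => rw [← h]
      rw [map_add, map_add]
      gcongr)
  convert key using 1
  rw [sPolynomial_def, mul_sub, ← mul_assoc, ← mul_assoc, monomial_mul, monomial_mul,
    (hG p hp).leadingCoeff_eq_one, (hG q hq).leadingCoeff_eq_one, mul_one,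
    tsub_add_tsub_cancel hle le_sup_left, tsub_add_tsub_cancel hle le_sup_right]
  congr 3
  · rw [← ha, add_tsub_cancel_right]
  · rw [← hb, add_tsub_cancel_right]

/-- Any two multiples with leading exponent exactly `d` agree up to lower ones, so the top layer
collapses to a scalar times a single multiple. -/
theorem mem_multiplesSpan_lt_or
    (hG : ∀ g ∈ G, m.Monic g) (hS : ∀ p ∈ G, ∀ q ∈ G, m.sPolynomial p q ∈
      m.multiplesSpan G fun d => m.toSyn d < m.toSyn (m.degree p ⊔ m.degree q))
    {h : MvPolynomial σ K} {d : σ →₀ ℕ}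
    (hh : h ∈ m.multiplesSpan G fun e => m.toSyn e ≤ m.toSyn d) :
    h ∈ m.multiplesSpan G (fun e => m.toSyn e < m.toSyn d) ∨ ∃ g ∈ G, ∃ a, ∃ c : K,
      a + m.degree g = d ∧
        h - c • (monomial a 1 * g) ∈ m.multiplesSpan G fun e => m.toSyn e < m.toSyn d := by
  induction hh using Submodule.span_induction with
  | mem x hx =>
    obtain ⟨a, g, hg, hP, rfl⟩ := hx
    rcases hP.lt_or_eq with hP | hP
    · exact .inl (monomial_mul_mem_multiplesSpan hg hP 1)
    · refine .inr ⟨g, hg, a, 1, m.toSyn.injective hP, ?_⟩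
      rw [one_smul, sub_self]
      exact Submodule.zero_mem _
  | zero => exact .inl (Submodule.zero_mem _)
  | add x y _ _ hx hy =>
    rcases hx with hx | ⟨g, hg, a, c, ha, hx⟩
    · rcases hy with hy | ⟨g, hg, a, c, ha, hy⟩
      · exact .inl (Submodule.add_mem _ hx hy)
      · refine .inr ⟨g, hg, a, c, ha, ?_⟩
        rw [add_sub_assoc]
        exact Submodule.add_mem _ hx hy
    · rcases hy with hy | ⟨g', hg', a', c', ha', hy⟩
      · refine .inr ⟨g, hg, a, c, ha, ?_⟩
        rw [add_sub_right_comm]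
        exact Submodule.add_mem _ hx hy
      · refine .inr ⟨g, hg, a, c + c', ha, ?_⟩
        have h := Submodule.add_mem _ (Submodule.add_mem _ hx hy) (Submodule.smul_mem _ c'
          (monomial_mul_sub_mem_multiplesSpan hG hS hg' hg ha' ha))
        convert h using 1
        simp only [smul_sub, add_smul]
        abel
  | smul c x _ hx =>
    rcases hx with hx | ⟨g, hg, a, c', ha, hx⟩
    · exact .inl (Submodule.smul_mem _ _ hx)
    · refine .inr ⟨g, hg, a, c * c', ha, ?_⟩
      rw [mul_smul, ← smul_sub]
      exact Submodule.smul_mem _ _ hx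

/-- **Buchberger's criterion**. -/
theorem exists_degree_le_of_sPolynomial_mem
    (hG : ∀ g ∈ G, m.Monic g) (hS : ∀ p ∈ G, ∀ q ∈ G, m.sPolynomial p q ∈
      m.multiplesSpan G fun d => m.toSyn d < m.toSyn (m.degree p ⊔ m.degree q))
    {h : MvPolynomial σ K} (hh : h ∈ Ideal.span G) (h0 : h ≠ 0) :
    ∃ g ∈ G, m.degree g ≤ m.degree h := by
  obtain ⟨d, hd⟩ : ∃ d, h ∈ m.multiplesSpan G fun e => m.toSyn e ≤ m.toSyn d := by
    obtain ⟨d, -, hd⟩ :=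
      (exists_le_of_mem_multiplesSpan (mem_multiplesSpan_of_mem_span (m := m) hh)).resolve_left h0
    exact ⟨d, hd⟩
  -- Induction on the bound for the leading exponents used in a representation of `h`; the
  -- representation may cancel at the top, in which case the bound can be lowered.
  induction hs : m.toSyn d using WellFoundedLT.induction generalizing d with
  | ind s ih =>
    subst hs
    have below (hlt : h ∈ m.multiplesSpan G fun e => m.toSyn e < m.toSyn d) :
        ∃ g ∈ G, m.degree g ≤ m.degree h := by
      obtain ⟨e, he, hmem⟩ := (exists_le_of_mem_multiplesSpan hlt).resolve_left h0
      exact ih _ he _ hmem rfl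
    rcases mem_multiplesSpan_lt_or hG hS hd with hlt | ⟨g, hg, a, c, ha, hlt⟩
    · exact below hlt
    by_cases hc : c = 0
    · rw [hc, zero_smul, sub_zero] at hlt
      exact below hlt
    -- With `c ≠ 0` nothing cancels the coefficient at `d`, so `d` is the leading exponent of `h`
    -- and `degree g` lies below it.
    have h1 : (monomial a (1 : K) * g).coeff d = 1 := by
      rw [← ha, coeff_monomial_mul, (hG g hg).coeff_degree, mul_one]
    have hcoeff : h.coeff d ≠ 0 := by
      have := coeff_eq_zero_of_mem_multiplesSpan hlt (d := d) fun _ => id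
      rw [coeff_sub, coeff_smul, h1, smul_eq_mul, mul_one, sub_eq_zero] at this
      rwa [this]
    have hdeg : m.degree h = d := by
      refine m.toSyn.injective (le_antisymm ?_ (m.le_degree (mem_support_iff.2 hcoeff)))
      by_contra hlt'
      exact m.coeff_degree_ne_zero_iff.2 h0
        (coeff_eq_zero_of_mem_multiplesSpan hd fun e he => he.trans_lt (not_le.1 hlt'))
    exact ⟨g, hg, by rw [hdeg, ← ha]; exact le_add_self⟩

/-- Over a field leading terms may be replaced by monomials with coefficient one, and a monomial
lies in a monomial ideal iff some generator divides it. -/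
theorem span_leadingTerm_eq_iff {I : Ideal (MvPolynomial σ K)} (hGI : G ⊆ I) :
    Ideal.span (m.leadingTerm '' G) = Ideal.span (m.leadingTerm '' (I : Set (MvPolynomial σ K))) ↔
      ∀ h ∈ I, h ≠ 0 → ∃ g ∈ G, g ≠ 0 ∧ m.degree g ≤ m.degree h := by
  classical
  have himage (S : Set (MvPolynomial σ K)) :
      (fun p ↦ monomial (m.degree p) (1 : K)) '' S = (monomial · 1) '' (m.degree '' S) := by
    rw [Set.image_image]
  rw [span_leadingTerm_eq_span_monomial', span_leadingTerm_eq_span_monomial', himage, himage]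
  constructor
  · intro h p hp hp0
    have hmem : monomial (m.degree p) (1 : K) ∈
        Ideal.span ((monomial · (1 : K)) '' (m.degree '' (G \ {0}))) := by
      rw [h]
      exact Ideal.subset_span ⟨_, ⟨p, ⟨hp, hp0⟩, rfl⟩, rfl⟩
    rw [mem_ideal_span_monomial_image] at hmem
    obtain ⟨_, ⟨g, ⟨hg, hg0⟩, rfl⟩, hle⟩ := hmem (m.degree p) (by simp [support_monomial])
    exact ⟨g, hg, hg0, hle⟩
  · intro h
    refine le_antisymm (Ideal.span_mono (Set.image_mono (Set.image_mono
      (Set.sdiff_subset_sdiff_left hGI)))) (Ideal.span_le.2 ?_)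
    rintro _ ⟨_, ⟨p, ⟨hp, hp0⟩, rfl⟩, rfl⟩
    obtain ⟨g, hg, hg0, hle⟩ := h p hp hp0
    rw [SetLike.mem_coe, mem_ideal_span_monomial_image]
    intro e he
    rw [Finset.mem_singleton.1 (support_monomial_subset he)]
    exact ⟨_, ⟨g, ⟨hg, hg0⟩, rfl⟩, hle⟩

/-- By Hilbert's basis theorem the ideal of leading monomials is generated by finitely many of them;
the polynomials they come from are scaled to be monic. -/
theorem exists_finite_degree_le [Finite σ] (m : MonomialOrder σ) (I : Ideal (MvPolynomial σ K)) :
    ∃ G : Finset (MvPolynomial σ K), ↑G ⊆ (I : Set (MvPolynomial σ K)) ∧ (∀ g ∈ G, m.Monic g) ∧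
      ∀ h ∈ I, h ≠ 0 → ∃ g ∈ G, m.degree g ≤ m.degree h := by
  classical
  have himage : (fun p ↦ monomial (m.degree p) (1 : K)) '' ((I : Set (MvPolynomial σ K)) \ {0}) =
      (monomial · 1) '' (m.degree '' ((I : Set (MvPolynomial σ K)) \ {0})) := by
    rw [Set.image_image]
  obtain ⟨S, hS, hspan⟩ := (Submodule.fg_span_iff_fg_span_finset_subset
    ((fun p ↦ monomial (m.degree p) (1 : K)) '' ((I : Set (MvPolynomial σ K)) \ {0}))).1
    ((isNoetherianRing_iff_ideal_fg (MvPolynomial σ K)).1 inferInstance (Ideal.span _))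
  obtain ⟨T, hT, rfl⟩ := Finset.subset_set_image_iff.1 hS
  refine ⟨T.image fun p => C (m.leadingCoeff p)⁻¹ * p, ?_, ?_, ?_⟩
  · intro g hg
    obtain ⟨p, hp, rfl⟩ := Finset.mem_image.1 (Finset.mem_coe.1 hg)
    exact I.mul_mem_left _ (hT hp).1
  · intro g hg
    obtain ⟨p, hp, rfl⟩ := Finset.mem_image.1 hg
    have hp0 : m.leadingCoeff p ≠ 0 := m.leadingCoeff_ne_zero_iff.2 (hT hp).2
    rw [Monic, leadingCoeff_mul_of_mul_leadingCoeff_ne_zero (by simpa using hp0), leadingCoeff_C,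
      inv_mul_cancel₀ hp0]
  · intro h hh h0
    have hmem : monomial (m.degree h) (1 : K) ∈
        Ideal.span ((monomial · (1 : K)) '' (m.degree '' (T : Set (MvPolynomial σ K)))) := by
      have hmem' : monomial (m.degree h) (1 : K) ∈ Ideal.span
          ((fun p ↦ monomial (m.degree p) (1 : K)) '' ((I : Set (MvPolynomial σ K)) \ {0})) :=
        Ideal.subset_span ⟨h, ⟨hh, h0⟩, rfl⟩
      rw [Ideal.span, hspan, Finset.coe_image] at hmem'
      rwa [Set.image_image]
    rw [mem_ideal_span_monomial_image] at hmem
    obtain ⟨_, ⟨p, hp, rfl⟩, hle⟩ := hmem (m.degree h) (by simp [support_monomial])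
    refine ⟨_, Finset.mem_image_of_mem _ hp, ?_⟩
    have hp0 : p ≠ 0 := (hT hp).2
    have hl : m.leadingCoeff p ≠ 0 := m.leadingCoeff_ne_zero_iff.2 hp0
    rwa [degree_mul (by simpa using hl) hp0, degree_C, zero_add]

/-- Every element of the ideal has a standard representation by a Gröbner basis. -/
theorem exists_standard_representation {ι : Type*} {b : ι → MvPolynomial σ K}
    {I : Ideal (MvPolynomial σ K)} (hb : ∀ i, m.Monic (b i)) (hbI : ∀ i, b i ∈ I)
    (hI : ∀ h ∈ I, h ≠ 0 → ∃ i, m.degree (b i) ≤ m.degree h) {h : MvPolynomial σ K} (hh : h ∈ I) :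
    ∃ q : ι →₀ MvPolynomial σ K, h = q.sum (fun i p => p * b i) ∧
      ∀ i, ∀ a ∈ (q i).support, m.toSyn (a + m.degree (b i)) ≤ m.toSyn (m.degree h) := by
  obtain ⟨q, r, hqr, hdeg, hr⟩ := m.div (b := b)
    (fun i => by rw [(hb i).leadingCoeff_eq_one]; exact isUnit_one) h
  have hrI : r ∈ I := by
    have : r = h - Finsupp.linearCombination _ b q := by rw [hqr, add_sub_cancel_left]
    rw [this]
    exact I.sub_mem hh (I.sum_mem fun i _ => I.mul_mem_left _ (hbI i))
  -- The remainder lies in the ideal, yet none of its exponents lies above a leading exponent of the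
  -- basis.
  have hr0 : r = 0 := by
    by_contra hr0
    obtain ⟨i, hi⟩ := hI r hrI hr0
    exact hr _ (m.degree_mem_support hr0) i hi
  refine ⟨q, ?_, fun i a ha => ?_⟩
  · rw [hqr, hr0, add_zero]
    rfl
  · refine le_trans ?_ (hdeg i)
    have hq : q i ≠ 0 := by rintro h0; simp [h0] at ha
    rw [degree_mul (hb i).ne_zero hq, map_add, map_add, add_comm]
    gcongr
    exact m.le_degree ha

end MonomialOrder

/-! ### The invariant ideal of the loop of an instance -/

namespace P2PInstance

variable {k : ℕ} (A : P2PInstance k)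

/-- The value of the variable `f` after `n` iterations. -/
noncomputable def fSeq (n : ℕ) : ℚ :=
  ∏ j ∈ Finset.range n, ∑ i, (A.seq j i - A.target i) ^ 2

/-- The valuation after `n` iterations. -/
noncomputable def state (n : ℕ) : Fin (k + 2) → ℚ :=
  Fin.cons (n : ℚ) (Fin.cons (A.fSeq n) (A.seq n))

@[simp] theorem state_gVar (n : ℕ) : A.state n (gVar k) = n := rfl

@[simp] theorem state_fVar (n : ℕ) : A.state n (fVar k) = A.fSeq n := rfl

@[simp] theorem state_xVar (n : ℕ) (i : Fin k) : A.state n (xVar i) = A.seq n i := rfl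

theorem fSeq_eq_zero_mono {m n : ℕ} (hmn : m ≤ n) (h : A.fSeq m = 0) : A.fSeq n = 0 := by
  obtain ⟨j, hj, h0⟩ := Finset.prod_eq_zero_iff.1 h
  exact Finset.prod_eq_zero
    (Finset.mem_range.2 ((Finset.mem_range.1 hj).trans_le hmn)) h0

/-- A sum of rational squares vanishes only termwise. As `fSeq n` multiplies over the times before
`n`, a hit at time `m` shows at `m + 1`. -/
theorem positive_iff_exists_fSeq_eq_zero : A.Positive ↔ ∃ n, A.fSeq n = 0 := by
  have key (j : ℕ) : ∑ i, (A.seq j i - A.target i) ^ 2 = 0 ↔ ∀ i, A.seq j i = A.target i := by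
    rw [Finset.sum_eq_zero_iff_of_nonneg fun _ _ => sq_nonneg _]
    simp [sub_eq_zero]
  constructor
  · rintro ⟨m, hm⟩
    exact ⟨m + 1, Finset.prod_eq_zero (Finset.self_mem_range_succ m) ((key m).2 hm)⟩
  · rintro ⟨n, hn⟩
    obtain ⟨j, -, hj⟩ := Finset.prod_eq_zero_iff.1 hn
    exact ⟨j, (key j).1 hj⟩

theorem eval_init (v : Fin (k + 2) → ℚ) : (fun i => eval v (A.toLoop.init i)) = A.state 0 := by
  funext i
  refine Fin.cases ?_ (fun i => ?_) i
  · simp [toLoop, state]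
  refine Fin.cases ?_ (fun i => ?_) i
  · simp [toLoop, state, fSeq]
  · simp [toLoop, state, seq]

theorem eval_update (n : ℕ) :
    (fun i => eval (A.state n) (A.toLoop.update i)) = A.state (n + 1) := by
  funext i
  refine Fin.cases ?_ (fun i => ?_) i
  · simp [toLoop, state, gVar]
  refine Fin.cases ?_ (fun i => ?_) i
  · simp only [toLoop, Fin.cons_succ, Fin.cons_zero, map_mul, eval_X, map_sum, map_pow, map_sub,
      eval_C, state_fVar, state_xVar]
    exact (Finset.prod_range_succ _ n).symm
  · simp only [toLoop, Fin.cons_succ, eval_rename]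
    rfl

theorem reachable_loop_iff {v : Fin (k + 2) → ℚ} :
    A.toLoop.Reachable .loop v ↔ ∃ n, v = A.state n := by
  constructor
  · intro h
    generalize hl : Location.loop = l at h
    induction h with
    | zero => cases hl
    | enter _ => exact ⟨0, A.eval_init _⟩
    | step _ ih =>
      obtain ⟨n, rfl⟩ := ih rfl
      exact ⟨n + 1, A.eval_update n⟩
  · rintro ⟨n, rfl⟩
    induction n with
    | zero => rw [← A.eval_init 0]; exact .enter .zero
    | succ n ih => rw [← A.eval_update n]; exact .step ih

theorem mem_invariantIdeal_iff {p : MvPolynomial (Fin (k + 2)) QBar} :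
    p ∈ A.toLoop.invariantIdeal ↔
      ∀ n, eval (fun i => algebraMap ℚ QBar (A.state n i)) p = 0 := by
  change (∀ v, _ → _) ↔ _
  simp only [A.reachable_loop_iff, forall_exists_index, forall_eq_apply_imp_iff]

end P2PInstance

theorem Fin.forall_variables {k : ℕ} {P : Fin (k + 2) → Prop} :
    (∀ i, P i) ↔ P (gVar k) ∧ P (fVar k) ∧ ∀ i : Fin k, P (xVar i) := by
  rw [Fin.forall_fin_succ, Fin.forall_fin_succ]
  rfl

theorem eval_hitPoly {k : ℕ} (A : P2PInstance k) (N n : ℕ) :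
    eval (fun i => algebraMap ℚ QBar (A.state n i)) (hitPoly k N) =
      algebraMap ℚ QBar (A.fSeq n) * ∏ j ∈ Finset.range N, ((n : QBar) - j) := by
  simp [hitPoly]

/-- At times `n < N` the factor `g - n` vanishes. At time `N` only `f` can vanish, and its zeros
persist at all later times. -/
theorem hitPoly_mem_invariantIdeal_iff {k : ℕ} (A : P2PInstance k) (N : ℕ) :
    hitPoly k N ∈ A.toLoop.invariantIdeal ↔ A.fSeq N = 0 := by
  rw [A.mem_invariantIdeal_iff]
  constructor
  · intro h
    have hN := h N
    rw [eval_hitPoly, mul_eq_zero, Finset.prod_eq_zero_iff] at hN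
    refine hN.elim (fun h0 => by simpa using h0) ?_
    rintro ⟨j, hj, h0⟩
    rw [sub_eq_zero, Nat.cast_inj] at h0
    exact absurd h0 (Finset.mem_range.1 hj).ne'
  · intro h n
    rw [eval_hitPoly]
    rcases lt_or_ge n N with hn | hn
    · rw [Finset.prod_eq_zero (Finset.mem_range.2 hn) (sub_self _), mul_zero]
    · rw [A.fSeq_eq_zero_mono hn h, map_zero, zero_mul]

/-! ### Polynomials in `g` and `f` of degree at most one in `f` -/

/-- A univariate polynomial in the variable `g`. -/
noncomputable def inG (k : ℕ) (p : Polynomial QBar) : MvPolynomial (Fin (k + 2)) QBar :=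
  Polynomial.aeval (X (gVar k)) p

theorem eval_inG {k : ℕ} (A : P2PInstance k) (p : Polynomial QBar) (n : ℕ) :
    eval (fun i => algebraMap ℚ QBar (A.state n i)) (inG k p) = p.eval (n : QBar) := by
  induction p using Polynomial.induction_on' with
  | add p q hp hq => rw [inG, map_add, map_add, Polynomial.eval_add, ← hp, ← hq]; rfl
  | monomial d c =>
    simp [inG, Polynomial.aeval_monomial, MvPolynomial.algebraMap_eq]

theorem hitPoly_eq (k N : ℕ) : hitPoly k N =
    inG k (∏ j ∈ Finset.range N, (Polynomial.X - Polynomial.C (j : QBar))) * X (fVar k) := by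
  rw [hitPoly, inG, map_prod, mul_comm]
  simp

/-- The terms of degree one in `f` are collected in `p`, those free of `f` in `q`. -/
theorem exists_eq_inG {k : ℕ} {h : MvPolynomial (Fin (k + 2)) QBar} {N : ℕ}
    (hh : ∀ d ∈ h.support, d (fVar k) ≤ 1 ∧ (∀ i : Fin k, d (xVar i) = 0) ∧
      (d (fVar k) = 1 → d (gVar k) ≤ N)) :
    ∃ p q : Polynomial QBar, h = inG k p * X (fVar k) + inG k q ∧ p.natDegree ≤ N ∧
      ((∀ d ∈ h.support, d (fVar k) = 1) → q = 0) := by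
  refine ⟨∑ d ∈ h.support with d (fVar k) = 1, Polynomial.monomial (d (gVar k)) (h.coeff d),
    ∑ d ∈ h.support with ¬ d (fVar k) = 1, Polynomial.monomial (d (gVar k)) (h.coeff d),
    ?_, ?_, ?_⟩
  · conv_lhs => rw [h.as_sum, ← Finset.sum_filter_add_sum_filter_not _ (fun d => d (fVar k) = 1)]
    have hmon (d : Fin (k + 2) →₀ ℕ) (hd : d ∈ h.support) : monomial d (h.coeff d) =
        inG k (Polynomial.monomial (d (gVar k)) (h.coeff d)) * X (fVar k) ^ d (fVar k) := by
      rw [inG, Polynomial.aeval_monomial, MvPolynomial.algebraMap_eq, monomial_eq,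
        Finsupp.prod_fintype _ _ (fun _ => pow_zero _), Fin.prod_univ_succ, Fin.prod_univ_succ,
        Finset.prod_eq_one (fun i _ => ?_), mul_one, mul_assoc]
      · rfl
      · have := (hh d hd).2.1 i
        rw [xVar] at this
        rw [this, pow_zero]
    simp only [inG, map_sum, Finset.sum_mul] at hmon ⊢
    congr 1
    · refine Finset.sum_congr rfl fun d hd => ?_
      rw [Finset.mem_filter] at hd
      rw [hmon d hd.1, hd.2, pow_one]
    · refine Finset.sum_congr rfl fun d hd => ?_
      rw [Finset.mem_filter] at hd
      have : d (fVar k) = 0 := by have := (hh d hd.1).1; omega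
      rw [hmon d hd.1, this, pow_zero, mul_one]
  · refine Polynomial.natDegree_sum_le_of_forall_le _ _ fun d hd => ?_
    rw [Finset.mem_filter] at hd
    exact (Polynomial.natDegree_monomial_le _).trans ((hh d hd.1).2.2 hd.2)
  · intro h1
    rw [Finset.filter_false_of_mem (fun d hd => not_not.2 (h1 d hd)), Finset.sum_empty]

theorem Polynomial.eq_zero_of_eval_natCast {p : Polynomial QBar} (N : ℕ)
    (h : ∀ n : ℕ, N ≤ n → p.eval (n : QBar) = 0) : p = 0 := by
  refine p.eq_zero_of_infinite_isRoot (Set.Infinite.mono ?_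
    (Set.infinite_range_of_injective (f := fun n : ℕ => ((N + n : ℕ) : QBar)) ?_))
  · rintro _ ⟨n, rfl⟩
    exact h _ (Nat.le_add_right N n)
  · intro a b hab
    simpa using hab

/-- If `f` never vanished, then `p` in `h = p(g) f` would have every natural number as a root. Thus
the shape `p(g) f` alone proves positivity, and the decision procedure need not determine the roots
of `p`. -/
theorem P2PInstance.positive_of_mem_invariantIdeal {k : ℕ} (A : P2PInstance k)
    {h : MvPolynomial (Fin (k + 2)) QBar} (hI : h ∈ A.toLoop.invariantIdeal) (h0 : h ≠ 0)
    (hh : ∀ d ∈ h.support, d (fVar k) = 1 ∧ ∀ i : Fin k, d (xVar i) = 0) : A.Positive := by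
  rw [A.positive_iff_exists_fSeq_eq_zero]
  by_contra! hf
  obtain ⟨p, q, heq, -, hq⟩ := exists_eq_inG (N := h.support.sup fun d => d (gVar k))
    fun d hd => ⟨(hh d hd).1.le, (hh d hd).2,
      fun _ => Finset.le_sup (f := fun d : Fin (k + 2) →₀ ℕ => d (gVar k)) hd⟩
  rw [hq fun d hd => (hh d hd).1] at heq
  have hp : p = 0 := Polynomial.eq_zero_of_eval_natCast 0 fun n _ => by
    have := A.mem_invariantIdeal_iff.1 hI n
    rw [heq, map_add, map_mul, eval_inG, eval_inG, eval_X] at this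
    simpa [hf n] using this
  rw [hp] at heq
  exact h0 (by simpa [inG] using heq)

/-! ### Reading off reachability -/

/-- Monomials are compared at the largest variable, with respect to `ord`, at which their exponents
differ; dualizing the order makes this the first position of the lexicographic comparison. -/
theorem lexOrder_lt_iff {n : ℕ} {ord : LinearOrder (Fin n)} {a b : Fin n →₀ ℕ} :
    (lexOrder ord).toSyn a < (lexOrder ord).toSyn b ↔
      ∃ i, (∀ j, ord.lt i j → a j = b j) ∧ a i < b i := Iff.rfl

/-- All `x_i` are larger than `f` and `g`, so a monomial not above `f g^N` contains none of them;
then `f` is compared, and `g` only in case of a tie. -/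
theorem lexOrder_le_exponents {k : ℕ} {ord : LinearOrder (Fin (k + 2))}
    (hgf : ord.lt (gVar k) (fVar k)) (hfx : ∀ i : Fin k, ord.lt (fVar k) (xVar i))
    {d : Fin (k + 2) →₀ ℕ} {N : ℕ} (hd : (lexOrder ord).toSyn d ≤
      (lexOrder ord).toSyn (Finsupp.single (fVar k) 1 + Finsupp.single (gVar k) N)) :
    d (fVar k) ≤ 1 ∧ (∀ i : Fin k, d (xVar i) = 0) ∧ (d (fVar k) = 1 → d (gVar k) ≤ N) := by
  have hfg : fVar k ≠ gVar k := Fin.succ_ne_zero (0 : Fin (k + 1))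
  have hxg (i : Fin k) : xVar i ≠ gVar k := Fin.succ_ne_zero _
  have hxf (i : Fin k) : xVar i ≠ fVar k := fun h =>
    Fin.succ_ne_zero i (Fin.succ_injective _ h)
  have ef : (Finsupp.single (fVar k) 1 + Finsupp.single (gVar k) N : Fin (k + 2) →₀ ℕ)
      (fVar k) = 1 := by simp [hfg.symm]
  have eg : (Finsupp.single (fVar k) 1 + Finsupp.single (gVar k) N : Fin (k + 2) →₀ ℕ)
      (gVar k) = N := by simp [hfg]
  have ex (i : Fin k) : (Finsupp.single (fVar k) 1 + Finsupp.single (gVar k) N :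
      Fin (k + 2) →₀ ℕ) (xVar i) = 0 := by simp [(hxg i).symm, (hxf i).symm]
  rcases hd.lt_or_eq with hd | hd
  · obtain ⟨i, heq, hlt⟩ := lexOrder_lt_iff.1 hd
    revert i
    rw [Fin.forall_variables]
    refine ⟨fun heq hlt => ?_, fun heq hlt => ?_, fun i _ hlt => ?_⟩
    · have hf := heq _ hgf
      rw [ef] at hf
      rw [eg] at hlt
      exact ⟨hf.le, fun i => (heq _ (@lt_trans _ ord.toPreorder _ _ _ hgf (hfx i))).trans (ex i),
        fun _ => hlt.le⟩
    · rw [ef] at hlt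
      exact ⟨hlt.le, fun i => (heq _ (hfx i)).trans (ex i), fun h => absurd h hlt.ne⟩
    · rw [ex] at hlt
      exact absurd hlt (Nat.not_lt_zero _)
  · rw [(lexOrder ord).toSyn.injective hd]
    exact ⟨ef.le, ex, fun _ => eg.le⟩

theorem monic_prod_gVar {k : ℕ} (m : MonomialOrder (Fin (k + 2))) (N : ℕ) :
    m.Monic (∏ j ∈ Finset.range N, (X (gVar k) - C (j : QBar))) ∧
      m.degree (∏ j ∈ Finset.range N, (X (gVar k) - C (j : QBar))) =
        Finsupp.single (gVar k) N := by
  induction N with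
  | zero =>
    rw [Finset.prod_range_zero, Finsupp.single_zero]
    exact ⟨m.monic_one, m.degree_one⟩
  | succ N ih =>
    rw [Finset.prod_range_succ]
    have hX := m.monic_X_sub_C (gVar k) (N : QBar)
    refine ⟨ih.1.mul hX, ?_⟩
    rw [m.degree_mul ih.1.ne_zero hX.ne_zero, ih.2, m.degree_X_sub_C, ← Finsupp.single_add]

theorem monic_hitPoly {k : ℕ} (m : MonomialOrder (Fin (k + 2))) (N : ℕ) :
    m.Monic (hitPoly k N) := by
  refine MonomialOrder.Monic.mul ?_ (monic_prod_gVar m N).1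
  exact m.leadingCoeff_X

theorem degree_hitPoly {k : ℕ} (m : MonomialOrder (Fin (k + 2))) (N : ℕ) :
    m.degree (hitPoly k N) = Finsupp.single (fVar k) 1 + Finsupp.single (gVar k) N := by
  rw [hitPoly, m.degree_mul (X_ne_zero _) (monic_prod_gVar m N).1.ne_zero, m.degree_X,
    (monic_prod_gVar m N).2]

/-- For the least `N` with `fSeq N = 0`, a nonzero invariant whose leading monomial divides that of
`P_N` is a scalar multiple of `P_N`, and a Gröbner basis must contain such an invariant. -/
theorem P2PInstance.positive_iff_groebner {k : ℕ} (A : P2PInstance k)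
    {ord : LinearOrder (Fin (k + 2))} (hgf : ord.lt (gVar k) (fVar k))
    (hfx : ∀ i : Fin k, ord.lt (fVar k) (xVar i)) {G : Set (MvPolynomial (Fin (k + 2)) QBar)}
    (hG : IsGroebnerBasis (lexOrder ord) A.toLoop.invariantIdeal G) :
    A.Positive ↔ ∃ (N : ℕ) (a : QBar), a ≠ 0 ∧ C a * hitPoly k N ∈ G := by
  classical
  obtain ⟨-, hspan, hlead⟩ := hG
  have hGI : G ⊆ A.toLoop.invariantIdeal := hspan ▸ Ideal.subset_span
  rw [A.positive_iff_exists_fSeq_eq_zero]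
  constructor
  · intro hpos
    have hN := Nat.find_spec hpos
    have hmin {n : ℕ} (hn : n < Nat.find hpos) := Nat.find_min hpos hn
    set N := Nat.find hpos
    obtain ⟨h, hhG, h0, hle⟩ := (MonomialOrder.span_leadingTerm_eq_iff hGI).1 hlead
      (hitPoly k N) ((hitPoly_mem_invariantIdeal_iff A N).2 hN)
      (monic_hitPoly (lexOrder ord) N).ne_zero
    rw [degree_hitPoly] at hle
    obtain ⟨p, q, heq, hdeg, -⟩ := exists_eq_inG (N := N) fun d hd =>
      lexOrder_le_exponents hgf hfx
        (((lexOrder ord).le_degree hd).trans ((lexOrder ord).toSyn_monotone hle))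
    have hev (n : ℕ) : p.eval (n : QBar) * algebraMap ℚ QBar (A.fSeq n) + q.eval (n : QBar) = 0 := by
      have := A.mem_invariantIdeal_iff.1 (hGI hhG) n
      rwa [heq, map_add, map_mul, eval_inG, eval_inG, eval_X, A.state_fVar] at this
    -- From time `N` on `f` is zero, so the invariant reduces to `q(n) = 0`.
    have hq : q = 0 := Polynomial.eq_zero_of_eval_natCast N fun n hn => by
      simpa [A.fSeq_eq_zero_mono hn hN] using hev n
    -- By minimality of `N`, `f` is nonzero at each `j < N`, so `p` has these `N` distinct roots.
    have hdvd : (∏ j ∈ Finset.range N, (Polynomial.X - Polynomial.C (j : QBar))) ∣ p := by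
      refine Finset.prod_dvd_of_coprime (fun i _ j _ hij => ?_) fun j hj => ?_
      · exact Polynomial.isCoprime_X_sub_C_of_isUnit_sub
          (sub_ne_zero.2 (Nat.cast_injective.ne hij)).isUnit
      · have := hev j
        rw [Polynomial.dvd_iff_isRoot, Polynomial.IsRoot]
        simpa [hq, hmin (Finset.mem_range.1 hj)] using this
    obtain ⟨r, rfl⟩ := hdvd
    have hmonic : (∏ j ∈ Finset.range N, (Polynomial.X - Polynomial.C (j : QBar))).Monic :=
      Polynomial.monic_prod_of_monic _ _ fun _ _ => Polynomial.monic_X_sub_C _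
    -- The degree of `p` is at most `N`, which the product of the `N` linear factors already
    -- exhausts.
    have hr : r.natDegree = 0 := by
      by_cases hr0 : r = 0
      · simp [hr0]
      rw [hmonic.natDegree_mul' hr0,
        Polynomial.natDegree_prod_of_monic _ _ fun _ _ => Polynomial.monic_X_sub_C _] at hdeg
      simpa only [Polynomial.natDegree_X_sub_C, Finset.sum_const, Finset.card_range, smul_eq_mul,
        mul_one, add_le_iff_nonpos_right, nonpos_iff_eq_zero] using hdeg
    rw [Polynomial.eq_C_of_natDegree_eq_zero hr] at heq
    have heq' : h = C (r.coeff 0) * hitPoly k N := by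
      rw [heq, hq, hitPoly_eq]
      simp only [inG, map_mul, map_zero, add_zero, Polynomial.aeval_C, MvPolynomial.algebraMap_eq]
      ring
    refine ⟨N, r.coeff 0, fun hc => h0 ?_, heq' ▸ hhG⟩
    rw [heq', hc, map_zero, zero_mul]
  · rintro ⟨N, a, ha, hmem⟩
    refine ⟨N, (hitPoly_mem_invariantIdeal_iff A N).1 ?_⟩
    have := A.toLoop.invariantIdeal.mul_mem_left (C a⁻¹) (hGI hmem)
    rwa [← mul_assoc, ← C_mul, inv_mul_cancel₀ ha, C_1, one_mul] at this

/-- Since `P_N` is monic, its only monic scalar multiple is itself. -/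
theorem P2PInstance.positive_iff_reduced_groebner {k : ℕ} (A : P2PInstance k)
    {ord : LinearOrder (Fin (k + 2))} (hgf : ord.lt (gVar k) (fVar k))
    (hfx : ∀ i : Fin k, ord.lt (fVar k) (xVar i)) {G : Set (MvPolynomial (Fin (k + 2)) QBar)}
    (hG : IsReducedGroebnerBasis (lexOrder ord) A.toLoop.invariantIdeal G) :
    A.Positive ↔ ∃ N : ℕ, hitPoly k N ∈ G := by
  rw [A.positive_iff_groebner hgf hfx hG.1]
  constructor
  · rintro ⟨N, a, ha, hmem⟩
    have h1 := hG.2.1 _ hmem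
    have hN := (monic_hitPoly (lexOrder ord) N).leadingCoeff_eq_one
    rw [MonomialOrder.leadingCoeff_mul_of_mul_leadingCoeff_ne_zero (by
      rw [hN, MonomialOrder.leadingCoeff_C, mul_one]; exact ha), hN,
      MonomialOrder.leadingCoeff_C, mul_one] at h1
    rw [h1, C_1, one_mul] at hmem
    exact ⟨N, hmem⟩
  · rintro ⟨N, hmem⟩
    exact ⟨N, 1, one_ne_zero, by rwa [C_1, one_mul]⟩

theorem MvPolynomial.coeff_list_sum {σ R : Type*} [CommSemiring R] (d : σ →₀ ℕ)
    (l : List (MvPolynomial σ R)) : coeff d l.sum = (l.map (coeff d)).sum :=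
  map_list_sum (coeffAddMonoidHom d) l

/-! ### Arithmetic of polynomial codes -/

/-- A pointwise operation on exponent lists. -/
def expOp (f : ℕ → ℕ → ℕ) (n : ℕ) (d e : List ℕ) : List ℕ :=
  (List.range n).map fun i => f (d.getD i 0) (e.getD i 0)

theorem getD_expOp {f : ℕ → ℕ → ℕ} {n i : ℕ} (d e : List ℕ) (hi : i < n) :
    (expOp f n d e).getD i 0 = f (d.getD i 0) (e.getD i 0) := by
  simp [expOp, List.getD_eq_getElem?_getD, List.getElem?_map, List.getElem?_range hi]

theorem exponentOf_apply (n : ℕ) (e : List ℕ) (i : Fin n) : exponentOf n e i = e.getD i 0 := rfl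

theorem List.getD_tail {α : Type*} (l : List α) (i : ℕ) (a : α) :
    l.tail.getD i a = l.getD (i + 1) a := by
  cases l <;> simp

/-- The exponents as a list of length `n`. -/
def normExp (n : ℕ) (e : List ℕ) : List ℕ := (List.range n).map fun i => e.getD i 0

/-- In flattened codes the head of an exponent list belongs to the generator of the coefficient
field and the tail to the `n` variables, hence the length `n + 1`. -/
theorem normExp_eq_iff {n : ℕ} {d e : List ℕ} :
    normExp (n + 1) d = normExp (n + 1) e ↔
      exponentOf n d.tail = exponentOf n e.tail ∧ d.getD 0 0 = e.getD 0 0 := by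
  rw [normExp, normExp, List.map_inj_left, Finsupp.ext_iff]
  simp only [List.mem_range, exponentOf_apply, List.getD_tail]
  constructor
  · exact fun h => ⟨fun i => h _ (by omega), h 0 (by omega)⟩
  · rintro ⟨h1, h2⟩ (_ | i) hi
    · exact h2
    · exact h1 ⟨i, by omega⟩

/-- The polynomial given by a code of which the first exponents are those of the generator of the
coefficient field. -/
noncomputable def flatOf (n : ℕ) (p : PolyCode) : MvPolynomial (Fin n) (Polynomial ℚ) :=
  (p.map fun t => monomial (exponentOf n t.1.tail)
    (Polynomial.monomial (t.1.getD 0 0) (ratOf t.2))).sum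

def mulCode (n : ℕ) (p q : PolyCode) : PolyCode :=
  p.flatMap fun t => q.map fun s => (expOp (· + ·) n t.1 s.1, ratMul t.2 s.2)

def negCode (p : PolyCode) : PolyCode := p.map fun t => (t.1, ratNeg t.2)

/-- The sum of the coefficients of the terms with the given exponents. -/
def coeffCode (n : ℕ) (p : PolyCode) (e : List ℕ) : RatCode :=
  (p.map fun s => if normExp n s.1 = normExp n e then s.2 else (0, 0)).foldr ratAdd (0, 0)

/-- The coefficients of all monomials vanish. -/
def IsZeroCode (n : ℕ) (p : PolyCode) : Prop := ∀ t ∈ p, (coeffCode n p t.1).1 = 0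

/-- Replace coefficients in `ℚ(α)` by their terms. -/
def flatten (c : AlgPolyCode) : PolyCode :=
  c.flatMap fun t => (List.range t.2.length).map fun i => (i :: t.1, t.2.getD i (0, 0))

@[simp] theorem flatOf_nil (n : ℕ) : flatOf n [] = 0 := rfl

@[simp] theorem flatOf_cons (n : ℕ) (t : List ℕ × RatCode) (p : PolyCode) : flatOf n (t :: p) =
    monomial (exponentOf n t.1.tail) (Polynomial.monomial (t.1.getD 0 0) (ratOf t.2)) +
      flatOf n p := by
  simp [flatOf]

@[simp] theorem flatOf_append (n : ℕ) (p q : PolyCode) :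
    flatOf n (p ++ q) = flatOf n p + flatOf n q := by
  simp [flatOf]

@[simp] theorem flatOf_negCode (n : ℕ) (p : PolyCode) : flatOf n (negCode p) = -flatOf n p := by
  induction p with
  | nil => simp [negCode]
  | cons t p ih =>
    rw [negCode] at ih
    rw [negCode, List.map_cons, flatOf_cons, ih, flatOf_cons, ratOf_ratNeg, map_neg, map_neg,
      neg_add]

@[simp] theorem flatOf_mulCode (n : ℕ) (p q : PolyCode) :
    flatOf n (mulCode (n + 1) p q) = flatOf n p * flatOf n q := by
  induction p with
  | nil => simp [mulCode]
  | cons t p ih =>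
    rw [mulCode] at ih
    rw [mulCode, List.flatMap_cons, flatOf_append, ih, flatOf_cons, add_mul]
    congr 1
    clear ih
    induction q with
    | nil => simp
    | cons s q ih =>
      rw [List.map_cons, flatOf_cons, ih, flatOf_cons, mul_add, monomial_mul,
        Polynomial.monomial_mul_monomial, ratOf_ratMul]
      congr 3
      · ext i
        simp only [exponentOf_apply, List.getD_tail, Finsupp.add_apply]
        exact getD_expOp _ _ (by omega)
      · rw [getD_expOp _ _ (by omega)]

theorem ratOf_coeffCode (n : ℕ) (p : PolyCode) (e : List ℕ) :
    ratOf (coeffCode (n + 1) p e) =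
      ((flatOf n p).coeff (exponentOf n e.tail)).coeff (e.getD 0 0) := by
  classical
  induction p with
  | nil => simp [coeffCode]
  | cons t p ih =>
    rw [coeffCode] at ih
    rw [coeffCode, List.map_cons, List.foldr_cons, ratOf_ratAdd, ih, flatOf_cons, coeff_add,
      coeff_monomial, Polynomial.coeff_add]
    congr 1
    by_cases h1 : exponentOf n t.1.tail = exponentOf n e.tail
    · by_cases h2 : t.1.getD 0 0 = e.getD 0 0
      · rw [if_pos (normExp_eq_iff.2 ⟨h1, h2⟩), if_pos h1, Polynomial.coeff_monomial, if_pos h2]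
      · rw [if_neg fun h => h2 (normExp_eq_iff.1 h).2, if_pos h1, Polynomial.coeff_monomial,
          if_neg h2, ratOf_zero]
    · rw [if_neg fun h => h1 (normExp_eq_iff.1 h).1, if_neg h1, ratOf_zero, Polynomial.coeff_zero]

theorem exists_mem_of_coeff_flatOf_ne_zero {n : ℕ} {p : PolyCode} {d : Fin n →₀ ℕ} {j : ℕ}
    (h : ((flatOf n p).coeff d).coeff j ≠ 0) :
    ∃ t ∈ p, exponentOf n t.1.tail = d ∧ t.1.getD 0 0 = j := by
  classical
  induction p with
  | nil => simp at h
  | cons t p ih =>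
    by_cases ht : exponentOf n t.1.tail = d ∧ t.1.getD 0 0 = j
    · exact ⟨t, List.mem_cons_self, ht⟩
    · obtain ⟨s, hs, hsd⟩ := ih fun h0 => h (by
        rw [flatOf_cons, coeff_add, Polynomial.coeff_add, h0, add_zero, coeff_monomial]
        split_ifs with hd
        · rw [Polynomial.coeff_monomial, if_neg fun hj => ht ⟨hd, hj⟩]
        · rfl)
      exact ⟨s, List.mem_cons_of_mem _ hs, hsd⟩

/-- A coefficient can be nonzero only at exponents that occur in the code, so finitely many sums
decide. -/
theorem isZeroCode_iff {n : ℕ} {p : PolyCode} : IsZeroCode (n + 1) p ↔ flatOf n p = 0 := by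
  constructor
  · intro h
    ext d j
    by_contra hne
    obtain ⟨t, ht, rfl, rfl⟩ := exists_mem_of_coeff_flatOf_ne_zero hne
    exact hne (by rw [← ratOf_coeffCode]; exact ratOf_eq_zero_iff.2 (h t ht))
  · intro h t _
    rw [← ratOf_eq_zero_iff, ratOf_coeffCode, h]
    simp

theorem uniPolyOf_coeff (c : UniPolyCode) (j : ℕ) :
    (uniPolyOf c).coeff j = ratOf (c.getD j (0, 0)) := by
  rw [uniPolyOf, Polynomial.finsetSum_coeff]
  simp only [Polynomial.coeff_C_mul_X_pow, Finset.sum_ite_eq, Finset.mem_range]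
  split_ifs with h
  · rfl
  · rw [List.getD_eq_default _ _ (not_lt.1 h), ratOf_zero]

theorem uniPolyOf_eq_sum (c : UniPolyCode) : uniPolyOf c =
    ((List.range c.length).map fun i => Polynomial.monomial i (ratOf (c.getD i (0, 0)))).sum := by
  rw [uniPolyOf, Finset.sum_range]
  simp only [Polynomial.C_mul_X_pow_eq_monomial]
  rw [← List.sum_ofFn, List.ofFn_eq_map]
  congr 1
  rw [← List.map_coe_finRange_eq_range, List.map_map]
  rfl

theorem degree_uniPolyOf_lt (c : UniPolyCode) : (uniPolyOf c).degree < c.length := by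
  rw [Polynomial.degree_lt_iff_coeff_zero]
  intro j hj
  rw [uniPolyOf_coeff, List.getD_eq_default _ _ hj, ratOf_zero]

theorem uniPolyOf_surjective (p : Polynomial ℚ) :
    ∃ c : UniPolyCode, uniPolyOf c = p ∧ c.length = p.natDegree + 1 := by
  choose r hr using ratOf_surjective
  refine ⟨(List.range (p.natDegree + 1)).map fun i => r (p.coeff i), ?_, by simp⟩
  ext j
  rw [uniPolyOf_coeff]
  by_cases hj : j < p.natDegree + 1
  · simp [List.getD_eq_getElem?_getD, List.getElem?_map, List.getElem?_range hj, hr]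
  · rw [List.getD_eq_default _ _ (by simpa using hj), ratOf_zero,
      Polynomial.coeff_eq_zero_of_natDegree_lt (by omega)]

theorem flatOf_flatten (n : ℕ) (c : AlgPolyCode) :
    flatOf n (flatten c) = (c.map fun t => monomial (exponentOf n t.1) (uniPolyOf t.2)).sum := by
  induction c with
  | nil => rfl
  | cons t c ih =>
    rw [flatten] at ih
    rw [flatten, List.flatMap_cons, flatOf_append, ih, List.map_cons, List.sum_cons]
    congr 1
    rw [flatOf, List.map_map, uniPolyOf_eq_sum, map_list_sum, List.map_map]
    rfl

/-- All computations take place over `ℚ[y]`; choosing a root is a ring homomorphism applied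
afterwards. Checked identities therefore hold for every root. -/
theorem algPolyOf_eq_map (n : ℕ) (α : QBar) (c : AlgPolyCode) :
    algPolyOf n α c =
      map (Polynomial.aeval α : Polynomial ℚ →ₐ[ℚ] QBar).toRingHom (flatOf n (flatten c)) := by
  rw [flatOf_flatten, map_list_sum, List.map_map, algPolyOf]
  congr 2
  funext t
  simp [map_monomial]

theorem exponentOf_surjective {n : ℕ} (d : Fin n →₀ ℕ) : ∃ e : List ℕ, exponentOf n e = d := by
  refine ⟨List.ofFn d, ?_⟩
  ext i
  rw [exponentOf_apply]
  simp [List.getD_eq_getElem?_getD]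

/-- The lengths of the coefficient lists are controlled because certificates bound degrees through
lengths. -/
theorem exists_flatten_eq {n : ℕ} (F : MvPolynomial (Fin n) (Polynomial ℚ)) :
    ∃ c : AlgPolyCode, flatOf n (flatten c) = F ∧ ∀ t ∈ c, exponentOf n t.1 ∈ F.support ∧
      t.2.length = (uniPolyOf t.2).natDegree + 1 ∧
      uniPolyOf t.2 = F.coeff (exponentOf n t.1) := by
  choose e he using exponentOf_surjective (n := n)
  choose u hu hl using uniPolyOf_surjective
  refine ⟨F.support.toList.map fun d => (e d, u (F.coeff d)), ?_, ?_⟩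
  · rw [flatOf_flatten, List.map_map]
    simp only [Function.comp_def, he, hu]
    rw [Finset.sum_map_toList]
    exact F.as_sum.symm
  · intro t ht
    obtain ⟨d, hd, rfl⟩ := List.mem_map.1 ht
    simp only [he, hu, hl]
    exact ⟨Finset.mem_toList.1 hd, trivial, trivial⟩

theorem exists_flatOf_eq {n : ℕ} (F : MvPolynomial (Fin n) (Polynomial ℚ)) :
    ∃ p : PolyCode, flatOf n p = F ∧ ∀ t ∈ p, exponentOf n t.1.tail ∈ F.support := by
  obtain ⟨c, hc, hsupp⟩ := exists_flatten_eq F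
  refine ⟨flatten c, hc, fun t ht => ?_⟩
  obtain ⟨s, hs, ht⟩ := List.mem_flatMap.1 ht
  obtain ⟨i, -, rfl⟩ := List.mem_map.1 ht
  exact (hsupp s hs).1

theorem exists_mem_of_mem_support_algPolyOf {n : ℕ} {α : QBar} {c : AlgPolyCode}
    {d : Fin n →₀ ℕ} (hd : d ∈ (algPolyOf n α c).support) : ∃ t ∈ c, exponentOf n t.1 = d := by
  classical
  rw [mem_support_iff] at hd
  by_contra! h
  refine hd ?_
  rw [algPolyOf, coeff_list_sum, List.map_map]
  refine List.sum_eq_zero fun x hx => ?_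
  obtain ⟨t, ht, rfl⟩ := List.mem_map.1 hx
  simp [coeff_monomial, h t ht]

/-- A code with coefficients of small degree vanishes in `ℚ(α)` only if it vanishes formally. -/
theorem flatOf_flatten_eq_zero {n : ℕ} {α : QBar} {μ : Polynomial ℚ} (hμ : Irreducible μ)
    (hα : Polynomial.aeval α μ = 0) {c : AlgPolyCode}
    (hc : ∀ t ∈ c, (uniPolyOf t.2).degree < μ.degree) (h : algPolyOf n α c = 0) :
    flatOf n (flatten c) = 0 := by
  classical
  ext1 d
  have hcoeff := congr_arg (coeff d) h
  rw [algPolyOf_eq_map, coeff_map, coeff_zero] at hcoeff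
  rw [coeff_zero]
  -- Up to a unit `μ` is the minimal polynomial of `α`, so it divides each coefficient vanishing at
  -- `α`; the degree bound then leaves only zero.
  have hdvd : μ ∣ (flatOf n (flatten c)).coeff d :=
    ((minpoly.eq_of_irreducible hμ hα ▸ (associated_mul_unit_right μ _ (by
      simpa using hμ.ne_zero))).dvd).trans (minpoly.dvd ℚ α hcoeff)
  refine Polynomial.eq_zero_of_dvd_of_degree_lt hdvd ?_
  rw [flatOf_flatten, coeff_list_sum, List.map_map]
  clear hdvd hcoeff h
  induction c with
  | nil =>
    simpa using bot_lt_iff_ne_bot.2 (Polynomial.degree_eq_bot.not.2 hμ.ne_zero)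
  | cons t c ih =>
    rw [List.map_cons, List.sum_cons]
    refine (Polynomial.degree_add_le _ _).trans_lt (max_lt ?_
      (ih fun s hs => hc s (List.mem_cons_of_mem _ hs)))
    simp only [Function.comp_apply, coeff_monomial]
    split_ifs
    · exact hc t List.mem_cons_self
    · simpa using bot_lt_iff_ne_bot.2 (Polynomial.degree_eq_bot.not.2 hμ.ne_zero)

/-! ### Primitive recursiveness of the arithmetic of codes -/

namespace Primrec

variable {α : Type*} [Primcodable α]

theorem list_getD_comp {β : Type*} [Primcodable β] {l : α → List β} {i : α → ℕ} (d : β)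
    (hl : Primrec l) (hi : Primrec i) : Primrec fun a => (l a).getD (i a) d :=
  (Primrec.list_getD d).comp hl hi

theorem expOp {f : ℕ → ℕ → ℕ} (hf : Primrec₂ f) {n : α → ℕ} {d e : α → List ℕ}
    (hn : Primrec n) (hd : Primrec d) (he : Primrec e) :
    Primrec fun a => expOp f (n a) (d a) (e a) :=
  Primrec.list_map (Primrec.list_range.comp hn)
    (hf.comp (list_getD_comp 0 (hd.comp Primrec.fst) Primrec.snd)
      (list_getD_comp 0 (he.comp Primrec.fst) Primrec.snd))

theorem normExp {n : α → ℕ} {e : α → List ℕ} (hn : Primrec n) (he : Primrec e) :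
    Primrec fun a => normExp (n a) (e a) :=
  Primrec.list_map (Primrec.list_range.comp hn)
    (list_getD_comp 0 (he.comp Primrec.fst) Primrec.snd)

theorem mulCode {n : α → ℕ} {p q : α → PolyCode} (hn : Primrec n) (hp : Primrec p)
    (hq : Primrec q) : Primrec fun a => mulCode (n a) (p a) (q a) := by
  refine Primrec.list_flatMap hp (Primrec.list_map (hq.comp Primrec.fst) ?_)
  have ht : Primrec fun x : (α × (List ℕ × RatCode)) × (List ℕ × RatCode) => x.1.2 :=
    Primrec.snd.comp Primrec.fst
  exact (expOp Primrec.nat_add ((hn.comp Primrec.fst).comp Primrec.fst)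
    (Primrec.fst.comp ht) (Primrec.fst.comp Primrec.snd)).pair
      (primrec_ratMul.comp (Primrec.snd.comp ht) (Primrec.snd.comp Primrec.snd))

theorem negCode {p : α → PolyCode} (hp : Primrec p) : Primrec fun a => negCode (p a) :=
  Primrec.list_map hp ((Primrec.fst.comp Primrec.snd).pair
    (primrec_ratNeg.comp (Primrec.snd.comp Primrec.snd)))

theorem coeffCode {n : α → ℕ} {p : α → PolyCode} {e : α → List ℕ} (hn : Primrec n)
    (hp : Primrec p) (he : Primrec e) : Primrec fun a => coeffCode (n a) (p a) (e a) := by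
  refine Primrec.list_foldr (h := fun _ x => ratAdd x.1 x.2) (Primrec.list_map hp ?_) (Primrec.const (0, 0))
    (primrec_ratAdd.comp (Primrec.fst.comp Primrec.snd) (Primrec.snd.comp Primrec.snd))
  exact Primrec.ite (Primrec.eq.comp
      (normExp (hn.comp Primrec.fst) (Primrec.fst.comp Primrec.snd))
      (normExp (hn.comp Primrec.fst) (he.comp Primrec.fst)))
    (Primrec.snd.comp Primrec.snd) (Primrec.const (0, 0))

theorem isZeroCode {n : α → ℕ} {p : α → PolyCode} (hn : Primrec n) (hp : Primrec p) :
    PrimrecPred fun a => IsZeroCode (n a) (p a) :=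
  PrimrecPred.forall_mem hp ((Primrec.eq.comp
    (Primrec.fst.comp (coeffCode (hn.comp Primrec.fst) (hp.comp Primrec.fst)
      (Primrec.fst.comp Primrec.snd))) (Primrec.const 0)))

theorem flatten {c : α → AlgPolyCode} (hc : Primrec c) : Primrec fun a => flatten (c a) := by
  refine Primrec.list_flatMap hc (Primrec.list_map
    (Primrec.list_range.comp (Primrec.list_length.comp (Primrec.snd.comp Primrec.snd))) ?_)
  have ht : Primrec fun x : (α × (List ℕ × UniPolyCode)) × ℕ => x.1.2 :=
    Primrec.snd.comp Primrec.fst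
  exact (Primrec.list_cons.comp Primrec.snd (Primrec.fst.comp ht)).pair
    (list_getD_comp (0, 0) (Primrec.snd.comp ht) Primrec.snd)

end Primrec

/-! ### Certificates for Gröbner bases -/

/-- The exponents `d` precede `e` in the lexicographic order. -/
def LexLt (n : ℕ) (d e : List ℕ) : Prop :=
  ∃ i ∈ List.range n, d.getD i 0 < e.getD i 0 ∧
    ∀ j ∈ List.range n, i < j → d.getD j 0 = e.getD j 0

theorem lexLt_iff {n : ℕ} {d e : List ℕ} : LexLt n d e ↔
    (lexOrder (inferInstance : LinearOrder (Fin n))).toSyn (exponentOf n d) <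
      (lexOrder (inferInstance : LinearOrder (Fin n))).toSyn (exponentOf n e) := by
  rw [lexOrder_lt_iff]
  simp only [LexLt, List.mem_range, exponentOf_apply]
  constructor
  · rintro ⟨i, hi, hlt, h⟩
    exact ⟨⟨i, hi⟩, fun j hj => h j j.2 hj, hlt⟩
  · rintro ⟨i, h, hlt⟩
    exact ⟨i, i.2, hlt, fun j hj hij => h ⟨j, hj⟩ hij⟩

theorem Primrec.lexLt {α : Type*} [Primcodable α] {n : α → ℕ} {d e : α → List ℕ}
    (hn : Primrec n) (hd : Primrec d) (he : Primrec e) :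
    PrimrecPred fun a => LexLt (n a) (d a) (e a) := by
  refine PrimrecPred.exists_mem (Primrec.list_range.comp hn) (?_)
  refine (Primrec.nat_lt.comp (Primrec.list_getD_comp 0 (hd.comp Primrec.fst) Primrec.snd)
    (Primrec.list_getD_comp 0 (he.comp Primrec.fst) Primrec.snd)).and ?_
  refine PrimrecPred.forall_mem (Primrec.list_range.comp (hn.comp Primrec.fst))
    (?_)
  have h : PrimrecPred fun x : (α × ℕ) × ℕ =>
      ¬ x.1.2 < x.2 ∨ (d x.1.1).getD x.2 0 = (e x.1.1).getD x.2 0 :=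
    (Primrec.nat_lt.comp (Primrec.snd.comp Primrec.fst) Primrec.snd).not.or
      (Primrec.eq.comp
        (Primrec.list_getD_comp 0 ((hd.comp Primrec.fst).comp Primrec.fst) Primrec.snd)
        (Primrec.list_getD_comp 0 ((he.comp Primrec.fst).comp Primrec.fst) Primrec.snd))
  exact h.of_eq fun x => by tauto

/-- A linear combination of generators, given by pairs of the index of a generator and its
coefficient, plus a multiple of the minimal polynomial. -/
abbrev CombCode : Type := PolyCode × List (ℕ × PolyCode)

/-- An index beyond the end of `hs` selects the empty code, that is zero, so indices need no range
check. -/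
def combCode (n : ℕ) (μ : PolyCode) (hs : List PolyCode) (c : CombCode) : PolyCode :=
  mulCode n c.1 μ ++ c.2.flatMap fun q => mulCode n q.2 (hs.getD q.1 [])

/-- The polynomial `f` equals the linear combination `c` of the generators `hs`. -/
def IsComb (n : ℕ) (μ : PolyCode) (hs : List PolyCode) (f : PolyCode) (c : CombCode) : Prop :=
  IsZeroCode n (f ++ negCode (combCode n μ hs c))

theorem Primrec.isComb {α : Type*} [Primcodable α] {n : α → ℕ} {μ : α → PolyCode}
    {hs : α → List PolyCode} {f : α → PolyCode} {c : α → CombCode} (hn : Primrec n)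
    (hμ : Primrec μ) (hhs : Primrec hs) (hf : Primrec f) (hc : Primrec c) :
    PrimrecPred fun a => IsComb (n a) (μ a) (hs a) (f a) (c a) := by
  refine Primrec.isZeroCode hn (Primrec.list_append.comp hf (Primrec.negCode
    (Primrec.list_append.comp (Primrec.mulCode hn (Primrec.fst.comp hc) hμ)
      (Primrec.list_flatMap (Primrec.snd.comp hc) ?_))))
  exact Primrec.mulCode (hn.comp Primrec.fst) (Primrec.snd.comp Primrec.snd)
    (Primrec.list_getD_comp [] (hhs.comp Primrec.fst) (Primrec.fst.comp Primrec.snd))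

/-- A monic polynomial, given by its leading exponents and its lower terms. -/
abbrev MonicCode : Type := List ℕ × AlgPolyCode

/-- With the leading coefficient one built in, monicity only requires comparing exponents, and no
inverse in `ℚ(α)` is ever computed. -/
def monicPoly (g : MonicCode) : AlgPolyCode := (g.1, [(1, 0)]) :: g.2

theorem Primrec.monicPoly {α : Type*} [Primcodable α] {g : α → MonicCode} (hg : Primrec g) :
    Primrec fun a => monicPoly (g a) :=
  Primrec.list_cons.comp ((Primrec.fst.comp hg).pair (Primrec.const [(1, 0)]))
    (Primrec.snd.comp hg)

/-- The code of the S-polynomial of two monic polynomials. -/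
def sPolyCode (n : ℕ) (p q : MonicCode) : PolyCode :=
  mulCode (n + 1) [(0 :: expOp (· - ·) n q.1 p.1, (1, 0))] (flatten (monicPoly p)) ++
    negCode (mulCode (n + 1) [(0 :: expOp (· - ·) n p.1 q.1, (1, 0))] (flatten (monicPoly q)))

theorem Primrec.sPolyCode {α : Type*} [Primcodable α] {n : α → ℕ} {p q : α → MonicCode}
    (hn : Primrec n) (hp : Primrec p) (hq : Primrec q) :
    Primrec fun a => sPolyCode (n a) (p a) (q a) := by
  have h {p q : α → MonicCode} (hp : Primrec p) (hq : Primrec q) : Primrec fun a =>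
      _root_.mulCode (n a + 1) [(0 :: _root_.expOp (· - ·) (n a) (q a).1 (p a).1, (1, 0))]
        (_root_.flatten (_root_.monicPoly (p a))) := by
    refine Primrec.mulCode (Primrec.succ.comp hn) (Primrec.list_cons.comp (Primrec.pair
      (Primrec.list_cons.comp (Primrec.const 0) ?_) (Primrec.const (1, 0))) (Primrec.const []))
      (Primrec.flatten (Primrec.monicPoly hp))
    exact Primrec.expOp Primrec.nat_sub hn (Primrec.fst.comp hq) (Primrec.fst.comp hp)
  exact Primrec.list_append.comp (h hp hq) (Primrec.negCode (h hq hp))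

/-- The elements of a Gröbner basis, the index of a nonzero coefficient of the minimal polynomial,
and a list of linear combinations. -/
abbrev GroebnerCert : Type := List MonicCode × ℕ × List CombCode

/-- The certificate shows that its polynomials form a Gröbner basis of the ideal generated by the
polynomials of `B`, and that their coefficients are reduced. -/
def GroebnerCert.Valid (n : ℕ) (B : BasisCode) (c : GroebnerCert) : Prop :=
  (B.1.getD c.2.1 (0, 0)).1 ≠ 0 ∧
  (∀ g ∈ c.1, ∀ t ∈ g.2, LexLt n t.1 g.1 ∧ t.2.length ≤ c.2.1) ∧
  (∀ s ∈ B.2, ∃ q ∈ c.2.2, IsComb (n + 1) (flatten [([], B.1)])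
    (c.1.map fun g => flatten (monicPoly g)) (flatten s) q) ∧
  (∀ g ∈ c.1, ∃ q ∈ c.2.2, IsComb (n + 1) (flatten [([], B.1)])
    (B.2.map flatten) (flatten (monicPoly g)) q) ∧
  ∀ g ∈ c.1, ∀ h ∈ c.1, ∃ q ∈ c.2.2, IsComb (n + 1) (flatten [([], B.1)])
    (c.1.map fun g => flatten (monicPoly g)) (sPolyCode n g h) q ∧
    ∀ l ∈ q.2, ∀ t ∈ l.2, LexLt n (expOp (· + ·) n t.1.tail (c.1.getD l.1 ([], [])).1)
      (expOp max n g.1 h.1)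

/-- Every quantifier ranges over a list contained in the data; in particular the linear combinations
are drawn from the certificate itself. -/
theorem primrecPred_valid :
    PrimrecPred fun x : ℕ × BasisCode × GroebnerCert => x.2.2.Valid x.1 x.2.1 := by
  have hn : Primrec fun x : ℕ × BasisCode × GroebnerCert => x.1 := Primrec.fst
  have hB : Primrec fun x : ℕ × BasisCode × GroebnerCert => x.2.1 :=
    Primrec.fst.comp Primrec.snd
  have hc : Primrec fun x : ℕ × BasisCode × GroebnerCert => x.2.2 :=
    Primrec.snd.comp Primrec.snd
  have hG := Primrec.fst.comp hc
  have hi := Primrec.fst.comp (Primrec.snd.comp hc)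
  have hQ := Primrec.snd.comp (Primrec.snd.comp hc)
  have hN := Primrec.succ.comp hn
  have hμ : Primrec fun x : ℕ × BasisCode × GroebnerCert => flatten [([], x.2.1.1)] :=
    Primrec.flatten (Primrec.list_cons.comp ((Primrec.const []).pair (Primrec.fst.comp hB))
      (Primrec.const []))
  have hGs : Primrec fun x : ℕ × BasisCode × GroebnerCert =>
      x.2.2.1.map fun g => flatten (monicPoly g) :=
    Primrec.list_map hG (Primrec.flatten (Primrec.monicPoly Primrec.snd))
  have hBs : Primrec fun x : ℕ × BasisCode × GroebnerCert => x.2.1.2.map flatten :=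
    Primrec.list_map (Primrec.snd.comp hB) (Primrec.flatten Primrec.snd)
  refine PrimrecPred.and ?_ (PrimrecPred.and ?_ (PrimrecPred.and ?_ (PrimrecPred.and ?_ ?_)))
  · exact (Primrec.eq.comp (Primrec.fst.comp
      (Primrec.list_getD_comp (0, 0) (Primrec.fst.comp hB) hi)) (Primrec.const 0)).not
  · refine PrimrecPred.forall_mem hG ((PrimrecPred.forall_mem
      (Primrec.snd.comp Primrec.snd) ((PrimrecPred.and ?_ ?_))))
    · exact Primrec.lexLt ((hn.comp Primrec.fst).comp Primrec.fst) (Primrec.fst.comp Primrec.snd)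
        (Primrec.fst.comp (Primrec.snd.comp Primrec.fst))
    · exact Primrec.nat_le.comp (Primrec.list_length.comp (Primrec.snd.comp Primrec.snd))
        ((hi.comp Primrec.fst).comp Primrec.fst)
  · refine PrimrecPred.forall_mem (Primrec.snd.comp hB) (
      (PrimrecPred.exists_mem (hQ.comp Primrec.fst) (?_)))
    exact Primrec.isComb ((hN.comp Primrec.fst).comp Primrec.fst)
      ((hμ.comp Primrec.fst).comp Primrec.fst) ((hGs.comp Primrec.fst).comp Primrec.fst)
      (Primrec.flatten (Primrec.snd.comp Primrec.fst)) Primrec.snd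
  · refine PrimrecPred.forall_mem hG (
      (PrimrecPred.exists_mem (hQ.comp Primrec.fst) (?_)))
    exact Primrec.isComb ((hN.comp Primrec.fst).comp Primrec.fst)
      ((hμ.comp Primrec.fst).comp Primrec.fst) ((hBs.comp Primrec.fst).comp Primrec.fst)
      (Primrec.flatten (Primrec.monicPoly (Primrec.snd.comp Primrec.fst))) Primrec.snd
  · refine PrimrecPred.forall_mem hG (
      (PrimrecPred.forall_mem (hG.comp Primrec.fst) (
        (PrimrecPred.exists_mem ((hQ.comp Primrec.fst).comp Primrec.fst)
          ((PrimrecPred.and ?_ ?_))))))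
    · exact Primrec.isComb (((hN.comp Primrec.fst).comp Primrec.fst).comp Primrec.fst)
        (((hμ.comp Primrec.fst).comp Primrec.fst).comp Primrec.fst)
        (((hGs.comp Primrec.fst).comp Primrec.fst).comp Primrec.fst)
        (Primrec.sPolyCode (((hn.comp Primrec.fst).comp Primrec.fst).comp Primrec.fst)
          (Primrec.snd.comp (Primrec.fst.comp Primrec.fst)) (Primrec.snd.comp Primrec.fst))
        Primrec.snd
    · refine PrimrecPred.forall_mem (Primrec.snd.comp Primrec.snd) (
        (PrimrecPred.forall_mem (Primrec.snd.comp Primrec.snd) (?_)))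
      have hn' := (((hn.comp Primrec.fst).comp (Primrec.fst (α := _ × MonicCode)
        (β := MonicCode))).comp (Primrec.fst (β := CombCode))).comp
        ((Primrec.fst (β := ℕ × PolyCode)).comp (Primrec.fst (β := List ℕ × RatCode)))
      have hG' := (((hG.comp Primrec.fst).comp (Primrec.fst (α := _ × MonicCode)
        (β := MonicCode))).comp (Primrec.fst (β := CombCode))).comp
        ((Primrec.fst (β := ℕ × PolyCode)).comp (Primrec.fst (β := List ℕ × RatCode)))
      refine Primrec.lexLt hn' (Primrec.expOp Primrec.nat_add hn'
        (Primrec.list_tail.comp (Primrec.fst.comp Primrec.snd))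
        (Primrec.fst.comp (Primrec.list_getD_comp ([], []) hG'
          (Primrec.fst.comp (Primrec.snd.comp Primrec.fst)))))
        (Primrec.expOp Primrec.nat_max hn' ?_ ?_)
      · exact Primrec.fst.comp (Primrec.snd.comp (Primrec.fst.comp (Primrec.fst.comp
          (Primrec.fst.comp Primrec.fst))))
      · exact Primrec.fst.comp (Primrec.snd.comp (Primrec.fst.comp
          (Primrec.fst.comp Primrec.fst)))

/-- The Gröbner basis of a certificate. -/
def GroebnerCert.basis (B : BasisCode) (c : GroebnerCert) : BasisCode := (B.1, c.1.map monicPoly)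

open Classical in
/-- Search for a certificate. -/
noncomputable def groebnerSearch (n : ℕ) (B : BasisCode) : Part BasisCode :=
  Nat.rfindOpt fun m => (Encodable.decode (α := GroebnerCert) m).bind fun c =>
    if c.Valid n B then some (c.basis B) else none

theorem partrec₂_groebnerSearch : Partrec₂ groebnerSearch := by
  classical
  refine Partrec.rfindOpt (Primrec.to_comp ?_)
  refine Primrec.option_bind (Primrec.decode.comp Primrec.snd) ?_
  have hB : Primrec fun x : ((ℕ × BasisCode) × ℕ) × GroebnerCert => x.1.1.2 :=
    Primrec.snd.comp (Primrec.fst.comp Primrec.fst)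
  refine Primrec.ite (primrecPred_valid.comp ((Primrec.fst.comp (Primrec.fst.comp
    Primrec.fst)).pair (hB.pair Primrec.snd))) (Primrec.option_some.comp ?_) (Primrec.const none)
  exact (Primrec.fst.comp hB).pair
    (Primrec.list_map (Primrec.fst.comp Primrec.snd) (Primrec.monicPoly Primrec.snd))

/-- Existence of a certificate ensures termination, but the search may return the basis of a
different one. Soundness is therefore proved for every valid certificate. -/
theorem exists_mem_groebnerSearch {n : ℕ} {B : BasisCode} (h : ∃ c : GroebnerCert, c.Valid n B) :
    ∃ c : GroebnerCert, c.Valid n B ∧ c.basis B ∈ groebnerSearch n B := by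
  classical
  obtain ⟨c, hc⟩ := h
  have hdom : (groebnerSearch n B).Dom := by
    rw [groebnerSearch, Nat.rfindOpt_dom]
    exact ⟨Encodable.encode c, c.basis B, by rw [Encodable.encodek]; simp [hc]⟩
  obtain ⟨B', hB'⟩ := Part.dom_iff_mem.1 hdom
  obtain ⟨m, hm⟩ := Nat.rfindOpt_spec hB'
  obtain ⟨c', -, h'⟩ := Option.mem_bind_iff.1 hm
  split_ifs at h' with hv
  · obtain rfl := Option.mem_some_iff.1 h'
    exact ⟨c', hv, hB'⟩
  · simp at h'

/-! ### Soundness of certificates -/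

theorem exponentOf_expOp_add (n : ℕ) (d e : List ℕ) :
    exponentOf n (expOp (· + ·) n d e) = exponentOf n d + exponentOf n e := by
  ext i
  exact getD_expOp d e i.2

theorem exponentOf_expOp_sub (n : ℕ) (d e : List ℕ) :
    exponentOf n (expOp (· - ·) n d e) = exponentOf n d - exponentOf n e := by
  ext i
  exact getD_expOp d e i.2

theorem exponentOf_expOp_max (n : ℕ) (d e : List ℕ) :
    exponentOf n (expOp max n d e) = exponentOf n d ⊔ exponentOf n e := by
  ext i
  exact getD_expOp d e i.2

theorem flatOf_flatMap (n : ℕ) {β : Type*} (l : List β) (f : β → PolyCode) :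
    flatOf n (l.flatMap f) = (l.map fun b => flatOf n (f b)).sum := by
  induction l with
  | nil => rfl
  | cons b l ih => rw [List.flatMap_cons, flatOf_append, ih, List.map_cons, List.sum_cons]

theorem flatOf_modulus (n : ℕ) (μ : UniPolyCode) :
    flatOf n (flatten [([], μ)]) = C (uniPolyOf μ) := by
  have h : exponentOf n [] = 0 := by
    ext i
    simp [exponentOf_apply]
  rw [flatOf_flatten, List.map_singleton, List.sum_singleton, h, C_apply]

theorem isComb_iff {n : ℕ} {μ f : PolyCode} {hs : List PolyCode} {c : CombCode} :
    IsComb (n + 1) μ hs f c ↔ flatOf n f = flatOf n c.1 * flatOf n μ +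
      (c.2.map fun q => flatOf n q.2 * flatOf n (hs.getD q.1 [])).sum := by
  rw [IsComb, isZeroCode_iff, flatOf_append, flatOf_negCode, ← sub_eq_add_neg, sub_eq_zero,
    combCode, flatOf_append, flatOf_mulCode, flatOf_flatMap]
  simp only [flatOf_mulCode]

theorem flatOf_monicPoly (n : ℕ) (g : MonicCode) : flatOf n (flatten (monicPoly g)) =
    monomial (exponentOf n g.1) 1 + flatOf n (flatten g.2) := by
  rw [monicPoly, flatOf_flatten, flatOf_flatten, List.map_cons, List.sum_cons]
  congr 2
  ext j
  rw [uniPolyOf_coeff, Polynomial.coeff_one]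
  cases j <;> simp

theorem flatOf_sPolyCode (n : ℕ) (g h : MonicCode) : flatOf n (sPolyCode n g h) =
    monomial (exponentOf n h.1 - exponentOf n g.1) 1 * flatOf n (flatten (monicPoly g)) -
      monomial (exponentOf n g.1 - exponentOf n h.1) 1 * flatOf n (flatten (monicPoly h)) := by
  rw [sPolyCode, flatOf_append, flatOf_negCode, flatOf_mulCode, flatOf_mulCode, flatOf_cons,
    flatOf_cons, flatOf_nil, ← sub_eq_add_neg]
  simp [exponentOf_expOp_sub]

theorem MonomialOrder.monic_monomial_add {σ K : Type*} [Field K] (m : MonomialOrder σ)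
    {e : σ →₀ ℕ} {p : MvPolynomial σ K} (hp : ∀ d ∈ p.support, m.toSyn d < m.toSyn e) :
    m.Monic (monomial e 1 + p) ∧ m.degree (monomial e 1 + p) = e := by
  classical
  have he : m.degree (monomial e (1 : K)) = e := by rw [m.degree_monomial]; simp
  by_cases h0 : p = 0
  · rw [h0, add_zero]
    exact ⟨m.monic_monomial_one, he⟩
  · have hlt : m.toSyn (m.degree p) < m.toSyn (m.degree (monomial e (1 : K))) := by
      rw [he]
      exact hp _ (m.degree_mem_support h0)
    exact ⟨m.monic_monomial_one.add_of_lt hlt, (m.degree_add_of_lt hlt).trans he⟩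

theorem exists_mem_of_mem_support_flatOf {n : ℕ} {p : PolyCode} {d : Fin n →₀ ℕ}
    (hd : d ∈ (flatOf n p).support) : ∃ t ∈ p, exponentOf n t.1.tail = d := by
  obtain ⟨j, hj⟩ : ∃ j, ((flatOf n p).coeff d).coeff j ≠ 0 := by
    by_contra! h
    exact mem_support_iff.1 hd (Polynomial.ext h)
  obtain ⟨t, ht, h, -⟩ := exists_mem_of_coeff_flatOf_ne_zero hj
  exact ⟨t, ht, h⟩

/-- Evaluation of the generator of the coefficient field at `α`. -/
noncomputable def evalCoeffs (n : ℕ) (α : QBar) :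
    MvPolynomial (Fin n) (Polynomial ℚ) →+* MvPolynomial (Fin n) QBar :=
  map (Polynomial.aeval α : Polynomial ℚ →ₐ[ℚ] QBar).toRingHom

namespace GroebnerCert

variable {n : ℕ} {B : BasisCode} {c : GroebnerCert}

/-- The lower terms have lexicographically smaller exponents already in the code, so the leading
exponent is the same for every `α`. -/
theorem Valid.monic (hc : c.Valid n B) (α : QBar) {g : MonicCode} (hg : g ∈ c.1) :
    (lexOrder (inferInstance : LinearOrder (Fin n))).Monic (algPolyOf n α (monicPoly g)) ∧
      (lexOrder (inferInstance : LinearOrder (Fin n))).degree (algPolyOf n α (monicPoly g)) =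
        exponentOf n g.1 := by
  have h : algPolyOf n α (monicPoly g) =
      monomial (exponentOf n g.1) 1 + algPolyOf n α g.2 := by
    rw [algPolyOf_eq_map, flatOf_monicPoly, map_add, map_monomial, map_one, ← algPolyOf_eq_map]
  rw [h]
  refine MonomialOrder.monic_monomial_add _ fun d hd => ?_
  obtain ⟨t, ht, rfl⟩ := exists_mem_of_mem_support_algPolyOf hd
  exact lexLt_iff.1 (hc.2.1 g hg t ht).1

/-- Evaluation at a root kills the multiples of the minimal polynomial, turning each certified
identity into one over `QBar`. Two families of identities give equality of the ideals, and the third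
is the hypothesis of Buchberger's criterion. -/
theorem isGroebnerBasis (hc : c.Valid n B) {α : QBar}
    (hα : Polynomial.aeval α (uniPolyOf B.1) = 0) :
    IsGroebnerBasis (lexOrder (inferInstance : LinearOrder (Fin n)))
      (Ideal.span {p | ∃ q ∈ B.2, algPolyOf n α q = p})
      {p | ∃ q ∈ (c.basis B).2, algPolyOf n α q = p} := by
  set m := lexOrder (inferInstance : LinearOrder (Fin n))
  set S : Set (MvPolynomial (Fin n) QBar) := {p | ∃ q ∈ B.2, algPolyOf n α q = p}
  set G : Set (MvPolynomial (Fin n) QBar) := {p | ∃ q ∈ (c.basis B).2, algPolyOf n α q = p}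
  have hev (q : AlgPolyCode) : algPolyOf n α q = evalCoeffs n α (flatOf n (flatten q)) :=
    algPolyOf_eq_map n α q
  have hGmem {g : MonicCode} (hg : g ∈ c.1) : algPolyOf n α (monicPoly g) ∈ G :=
    ⟨_, List.mem_map_of_mem hg, rfl⟩
  have hμ : evalCoeffs n α (flatOf n (flatten [([], B.1)])) = 0 := by
    rw [flatOf_modulus, evalCoeffs, map_C]
    exact (congr_arg C hα).trans C_0
  have hcomb {hs : List PolyCode} {f : PolyCode} {q : CombCode}
      (h : IsComb (n + 1) (flatten [([], B.1)]) hs f q) : evalCoeffs n α (flatOf n f) =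
      (q.2.map fun l => evalCoeffs n α (flatOf n l.2) *
        evalCoeffs n α (flatOf n (hs.getD l.1 []))).sum := by
    rw [isComb_iff.1 h, map_add, map_mul, hμ, mul_zero, zero_add, map_list_sum, List.map_map]
    simp only [Function.comp_def, map_mul]
  have hspan {hs : List PolyCode} {f : PolyCode} {q : CombCode}
      (h : IsComb (n + 1) (flatten [([], B.1)]) hs f q) {I : Ideal (MvPolynomial (Fin n) QBar)}
      (hI : ∀ p ∈ hs, evalCoeffs n α (flatOf n p) ∈ I) : evalCoeffs n α (flatOf n f) ∈ I := by
    rw [hcomb h]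
    refine list_sum_mem fun x hx => ?_
    obtain ⟨l, -, rfl⟩ := List.mem_map.1 hx
    refine I.mul_mem_left _ ?_
    rcases lt_or_ge l.1 hs.length with hl | hl
    · rw [List.getD_eq_getElem _ _ hl]
      exact hI _ (List.getElem_mem hl)
    · rw [List.getD_eq_default _ _ hl, flatOf_nil, map_zero]
      exact I.zero_mem
  have hGS : Ideal.span G = Ideal.span S := by
    refine le_antisymm (Ideal.span_le.2 ?_) (Ideal.span_le.2 ?_)
    · rintro _ ⟨q, hq, rfl⟩
      obtain ⟨g, hg, rfl⟩ := List.mem_map.1 hq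
      obtain ⟨q, -, hq⟩ := hc.2.2.2.1 g hg
      rw [hev]
      refine hspan hq fun p hp => ?_
      obtain ⟨s, hs, rfl⟩ := List.mem_map.1 hp
      exact Ideal.subset_span ⟨s, hs, hev s⟩
    · rintro _ ⟨s, hs, rfl⟩
      obtain ⟨q, -, hq⟩ := hc.2.2.1 s hs
      rw [hev]
      refine hspan hq fun p hp => ?_
      obtain ⟨g, hg, rfl⟩ := List.mem_map.1 hp
      rw [← hev]
      exact Ideal.subset_span (hGmem hg)
  have hmonic : ∀ p ∈ G, m.Monic p := by
    rintro _ ⟨q, hq, rfl⟩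
    obtain ⟨g, hg, rfl⟩ := List.mem_map.1 hq
    exact (hc.monic α hg).1
  refine ⟨(List.finite_toSet ((c.basis B).2.map (algPolyOf n α))).subset fun p hp => ?_, hGS, ?_⟩
  · obtain ⟨q, hq, rfl⟩ := hp
    exact List.mem_map_of_mem hq
  rw [← hGS, m.span_leadingTerm_eq_iff Ideal.subset_span]
  intro h hh h0
  suffices ∃ g ∈ G, m.degree g ≤ m.degree h by
    obtain ⟨g, hg, hle⟩ := this
    exact ⟨g, hg, (hmonic g hg).ne_zero, hle⟩
  refine MonomialOrder.exists_degree_le_of_sPolynomial_mem hmonic ?_ hh h0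
  rintro _ ⟨q, hq, rfl⟩ _ ⟨q', hq', rfl⟩
  obtain ⟨g, hg, rfl⟩ := List.mem_map.1 hq
  obtain ⟨g', hg', rfl⟩ := List.mem_map.1 hq'
  obtain ⟨q, -, hq, hdeg⟩ := hc.2.2.2.2 g hg g' hg'
  have hmon (d : Fin n →₀ ℕ) : evalCoeffs n α (monomial d 1) = monomial d 1 := by
    simp [evalCoeffs, map_monomial]
  have hs : m.sPolynomial (algPolyOf n α (monicPoly g)) (algPolyOf n α (monicPoly g')) =
      evalCoeffs n α (flatOf n (sPolyCode n g g')) := by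
    rw [MonomialOrder.sPolynomial, (hc.monic α hg).2, (hc.monic α hg').2,
      (hc.monic α hg).1.leadingCoeff_eq_one, (hc.monic α hg').1.leadingCoeff_eq_one,
      flatOf_sPolyCode, map_sub, map_mul, map_mul, ← hev, ← hev, hmon, hmon]
  rw [hs, hcomb hq, (hc.monic α hg).2, (hc.monic α hg').2]
  refine list_sum_mem fun x hx => ?_
  obtain ⟨l, hl, rfl⟩ := List.mem_map.1 hx
  rcases lt_or_ge l.1 c.1.length with hlt | hge
  · rw [List.getD_eq_getElem _ _ (by simpa using hlt), List.getElem_map, ← hev]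
    refine MonomialOrder.mul_mem_multiplesSpan (hGmem (List.getElem_mem hlt)) fun d hd => ?_
    -- Evaluation at `α` can only remove monomials, so the bound checked on the formal terms
    -- suffices.
    obtain ⟨t, ht, rfl⟩ := exists_mem_of_mem_support_flatOf (support_map_subset _ _ hd)
    have := lexLt_iff.1 (hdeg l hl t ht)
    rwa [exponentOf_expOp_add, exponentOf_expOp_max, List.getD_eq_getElem _ _ hlt,
      ← (hc.monic α (List.getElem_mem hlt)).2] at this
  · rw [List.getD_eq_default _ _ (by simpa using hge), flatOf_nil, map_zero, mul_zero]
    exact Submodule.zero_mem _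

/-- A nonzero coefficient at index `i` shows that the minimal polynomial has degree at least `i`,
whereas a list of length at most `i` has smaller degree. The degree itself need not be computed. -/
theorem Valid.degree_lt (hc : c.Valid n B) (hμ : Irreducible (uniPolyOf B.1)) {q : AlgPolyCode}
    (hq : q ∈ (c.basis B).2) : ∀ t ∈ q, (uniPolyOf t.2).degree < (uniPolyOf B.1).degree := by
  obtain ⟨g, hg, rfl⟩ := List.mem_map.1 hq
  have hle : ((c.2.1 : ℕ) : WithBot ℕ) ≤ (uniPolyOf B.1).degree :=
    Polynomial.le_degree_of_ne_zero (by
      rw [uniPolyOf_coeff, Ne, ratOf_eq_zero_iff]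
      exact hc.1)
  intro t ht
  rcases List.mem_cons.1 ht with rfl | ht
  · refine lt_of_lt_of_le (degree_uniPolyOf_lt _) ?_
    rw [Polynomial.degree_eq_natDegree hμ.ne_zero]
    exact_mod_cast hμ.natDegree_pos
  · refine ((degree_uniPolyOf_lt _).trans_le ?_).trans_le hle
    exact_mod_cast (hc.2.1 g hg t ht).2

end GroebnerCert

/-! ### Existence of certificates -/

section Existence

variable {n : ℕ} {μ : Polynomial ℚ}

/-- Each coefficient in the support is replaced by a remainder modulo `μ`, and the other
coefficients by zero, so no monomials are added. -/
theorem exists_lift_adjoinRoot (hμ : Irreducible μ) (p : MvPolynomial (Fin n) (AdjoinRoot μ)) :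
    ∃ F : MvPolynomial (Fin n) (Polynomial ℚ), map (AdjoinRoot.mk μ) F = p ∧
      F.support ⊆ p.support ∧ ∀ d, (F.coeff d).natDegree < μ.natDegree := by
  classical
  have hrep (x : AdjoinRoot μ) :
      ∃ r : Polynomial ℚ, AdjoinRoot.mk μ r = x ∧ r.natDegree < μ.natDegree := by
    obtain ⟨r, rfl⟩ := AdjoinRoot.mk_surjective x
    refine ⟨r % μ, ?_, Polynomial.natDegree_mod_lt r hμ.natDegree_pos.ne'⟩
    rw [AdjoinRoot.mk_eq_mk]
    exact ⟨-(r / μ), by linear_combination (EuclideanDomain.div_add_mod r μ)⟩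
  choose rep hmk hdeg using hrep
  have hcoeff (d : Fin n →₀ ℕ) :
      (∑ d ∈ p.support, monomial d (rep (p.coeff d))).coeff d =
        if d ∈ p.support then rep (p.coeff d) else 0 := by
    simp only [coeff_sum, coeff_monomial, Finset.sum_ite_eq']
  refine ⟨∑ d ∈ p.support, monomial d (rep (p.coeff d)), ?_, fun d hd => ?_, fun d => ?_⟩
  · simp only [map_sum, map_monomial, hmk]
    exact p.as_sum.symm
  · rw [mem_support_iff, hcoeff] at hd
    by_contra h
    exact hd (if_neg h)
  · rw [hcoeff]
    split_ifs
    · exact hdeg _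
    · simpa using hμ.natDegree_pos

/-- An identity modulo `μ` lifts to `ℚ[y]` up to an element of the kernel of reduction, which is a
multiple of `μ`; the cofactor is the first component of the code. Control of the supports preserves
bounds on leading exponents. -/
theorem exists_isComb (hμ : Irreducible μ) {ν : PolyCode} (hν : flatOf n ν = C μ)
    (hs : List PolyCode) (f : PolyCode)
    (q : Fin hs.length → MvPolynomial (Fin n) (AdjoinRoot μ))
    (h : map (AdjoinRoot.mk μ) (flatOf n f) =
      ∑ j, q j * map (AdjoinRoot.mk μ) (flatOf n (hs.get j))) :
    ∃ c : CombCode, IsComb (n + 1) ν hs f c ∧ ∀ l ∈ c.2, ∀ t ∈ l.2,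
      ∃ j : Fin hs.length, l.1 = j ∧ exponentOf n t.1.tail ∈ (q j).support := by
  have hlift (j : Fin hs.length) : ∃ p : PolyCode,
      map (AdjoinRoot.mk μ) (flatOf n p) = q j ∧
        ∀ t ∈ p, exponentOf n t.1.tail ∈ (q j).support := by
    obtain ⟨F, hF, hsupp, -⟩ := exists_lift_adjoinRoot hμ (q j)
    obtain ⟨p, rfl, hp⟩ := exists_flatOf_eq F
    exact ⟨p, hF, fun t ht => hsupp (hp t ht)⟩
  choose p hp hsupp using hlift
  have hker : flatOf n f - ∑ j, flatOf n (p j) * flatOf n (hs.get j) ∈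
      RingHom.ker (map (σ := Fin n) (AdjoinRoot.mk μ)) := by
    rw [RingHom.mem_ker, map_sub, h, map_sum, sub_eq_zero]
    simp only [map_mul, hp]
  rw [ker_map, show RingHom.ker (AdjoinRoot.mk μ) = Ideal.span {μ} from Ideal.mk_ker, Ideal.map_span, Set.image_singleton,
    Ideal.mem_span_singleton'] at hker
  obtain ⟨r, hr⟩ := hker
  obtain ⟨r, rfl, -⟩ := exists_flatOf_eq r
  refine ⟨(r, (List.finRange hs.length).map fun j : Fin hs.length => ((j : ℕ), p j)), ?_, ?_⟩
  · rw [isComb_iff, hν, hr, List.map_map]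
    have : ((List.finRange hs.length).map ((fun q : ℕ × PolyCode => flatOf n q.2 *
        flatOf n (hs.getD q.1 [])) ∘ fun j : Fin hs.length => ((j : ℕ), p j))).sum =
        ∑ j, flatOf n (p j) * flatOf n (hs.get j) := by
      rw [← List.ofFn_eq_map, List.sum_ofFn]
      refine Finset.sum_congr rfl fun j _ => ?_
      simp
    rw [this, sub_add_cancel]
  · intro l hl t ht
    obtain ⟨j, -, rfl⟩ := List.mem_map.1 hl
    exact ⟨j, rfl, hsupp j t ht⟩

theorem List.exists_witnesses {β γ : Type*} {P : β → γ → Prop} (l : List β)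
    (h : ∀ b ∈ l, ∃ c, P b c) : ∃ w : List γ, ∀ b ∈ l, ∃ c ∈ w, P b c := by
  induction l with
  | nil => exact ⟨[], by simp⟩
  | cons b l ih =>
    obtain ⟨c, hc⟩ := h b List.mem_cons_self
    obtain ⟨w, hw⟩ := ih fun b hb => h b (List.mem_cons_of_mem _ hb)
    refine ⟨c :: w, fun b' hb' => ?_⟩
    rcases List.mem_cons.1 hb' with rfl | hb'
    · exact ⟨c, List.mem_cons_self, hc⟩
    · obtain ⟨c', hc', hP⟩ := hw b' hb'
      exact ⟨c', List.mem_cons_of_mem _ hc', hP⟩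

theorem exists_monicCode (hμ : Irreducible μ) {m : MonomialOrder (Fin n)}
    {g : MvPolynomial (Fin n) (AdjoinRoot μ)} (hg : m.Monic g) :
    ∃ c : MonicCode, exponentOf n c.1 = m.degree g ∧
      map (AdjoinRoot.mk μ) (flatOf n (flatten (monicPoly c))) = g ∧
      ∀ t ∈ c.2, m.toSyn (exponentOf n t.1) < m.toSyn (exponentOf n c.1) ∧
        t.2.length ≤ μ.natDegree := by
  classical
  obtain ⟨F, hF, hsupp, hdeg⟩ := exists_lift_adjoinRoot hμ (g - monomial (m.degree g) 1)
  obtain ⟨q, rfl, hq⟩ := exists_flatten_eq F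
  obtain ⟨e, he⟩ := exponentOf_surjective (m.degree g)
  refine ⟨(e, q), he, ?_, fun t ht => ?_⟩
  · rw [flatOf_monicPoly, map_add, hF, map_monomial, map_one, he, add_sub_cancel]
  · obtain ⟨h1, h2, h3⟩ := hq t ht
    refine ⟨?_, ?_⟩
    · have hmem := mem_support_iff.1 (hsupp h1)
      rw [coeff_sub, coeff_monomial] at hmem
      have hne : m.degree g ≠ exponentOf n t.1 := by
        intro heq
        rw [if_pos heq, ← heq, hg.coeff_degree, sub_self] at hmem
        exact hmem rfl
      rw [if_neg hne, sub_zero] at hmem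
      rw [he]
      exact lt_of_le_of_ne (m.le_degree (mem_support_iff.2 hmem))
        (m.toSyn.injective.ne hne.symm)
    · rw [h2, h3]
      exact hdeg _

/-- The ideal is formed over `ℚ[y]/(μ)` rather than over `QBar`, so that a Gröbner basis and its
combinations lift to rational codes. -/
theorem GroebnerCert.exists_valid (n : ℕ) {B : BasisCode} (hμ : Irreducible (uniPolyOf B.1)) :
    ∃ c : GroebnerCert, c.Valid n B := by
  classical
  set m := lexOrder (inferInstance : LinearOrder (Fin n)) with hm
  have : Fact (Irreducible (uniPolyOf B.1)) := ⟨hμ⟩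
  let ψ : MvPolynomial (Fin n) (Polynomial ℚ) →+*
    MvPolynomial (Fin n) (AdjoinRoot (uniPolyOf B.1)) := map (AdjoinRoot.mk (uniPolyOf B.1))
  let hs := B.2.map flatten
  let I : Ideal (MvPolynomial (Fin n) (AdjoinRoot (uniPolyOf B.1))) :=
    Ideal.span (Set.range fun j : Fin hs.length => ψ (flatOf n (hs.get j)))
  obtain ⟨T, hTI, hTmonic, hT⟩ := MonomialOrder.exists_finite_degree_le m I
  have hcode (g : T) := exists_monicCode hμ (hTmonic g g.2)
  choose code hcode1 hcode2 hcode3 using hcode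
  let G : List MonicCode := T.attach.toList.map code
  have hG {g : MonicCode} (hg : g ∈ G) : ∃ p : T, code p = g := by
    obtain ⟨p, -, rfl⟩ := List.mem_map.1 hg
    exact ⟨p, rfl⟩
  let gs := G.map fun g => flatten (monicPoly g)
  have hgs : gs.length = G.length := List.length_map ..
  have hget (j : Fin gs.length) :
      gs.get j = flatten (monicPoly (G.get ⟨j, hgs ▸ j.2⟩)) := by
    simp [gs]
  have hb (j : Fin gs.length) : ∃ p : T, code p = G.get ⟨j, hgs ▸ j.2⟩ ∧
      ψ (flatOf n (gs.get j)) = p := by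
    obtain ⟨p, hp⟩ := hG (List.get_mem G ⟨j, hgs ▸ j.2⟩)
    exact ⟨p, hp, by rw [hget, ← hp]; exact hcode2 p⟩
  have hstd {h : MvPolynomial (Fin n) (AdjoinRoot (uniPolyOf B.1))} (hh : h ∈ I) :
      ∃ q : Fin gs.length → MvPolynomial (Fin n) (AdjoinRoot (uniPolyOf B.1)),
        h = ∑ j, q j * ψ (flatOf n (gs.get j)) ∧ ∀ j, ∀ a ∈ (q j).support,
          m.toSyn (a + m.degree (ψ (flatOf n (gs.get j)))) ≤ m.toSyn (m.degree h) := by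
    obtain ⟨q, hq, hdeg⟩ := MonomialOrder.exists_standard_representation (m := m)
      (b := fun j : Fin gs.length => ψ (flatOf n (gs.get j))) (I := I)
      (fun j => by obtain ⟨p, -, hp⟩ := hb j; rw [hp]; exact hTmonic p p.2)
      (fun j => by obtain ⟨p, -, hp⟩ := hb j; rw [hp]; exact hTI p.2)
      (fun h hh h0 => by
        obtain ⟨p, hp, hle⟩ := hT h hh h0
        have hmem : code ⟨p, hp⟩ ∈ G :=
          List.mem_map_of_mem (Finset.mem_toList.2 (Finset.mem_attach _ _))
        obtain ⟨j, hj⟩ := List.get_of_mem hmem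
        refine ⟨⟨j, hgs.symm ▸ j.2⟩, ?_⟩
        rw [hget]
        change m.degree (ψ (flatOf n (flatten (monicPoly (G.get j))))) ≤ _
        rw [hj]
        exact (congr_arg m.degree (hcode2 ⟨p, hp⟩)).trans_le hle) hh
    refine ⟨q, ?_, hdeg⟩
    rw [hq, Finsupp.sum_fintype _ _ fun _ => zero_mul _]
  have hν := flatOf_modulus n B.1
  obtain ⟨W1, hW1⟩ := List.exists_witnesses (P := fun s q =>
      IsComb (n + 1) (flatten [([], B.1)]) gs (flatten s) q) B.2 fun s hs' => by
    have hmem : ψ (flatOf n (flatten s)) ∈ I := by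
      obtain ⟨j, hj⟩ := List.get_of_mem (List.mem_map_of_mem (f := flatten) hs')
      exact Ideal.subset_span ⟨j, by rw [← hj]⟩
    obtain ⟨q, hq, -⟩ := hstd hmem
    obtain ⟨c, hc, -⟩ := exists_isComb hμ hν gs (flatten s) q hq
    exact ⟨c, hc⟩
  obtain ⟨W2, hW2⟩ := List.exists_witnesses (P := fun g q =>
      IsComb (n + 1) (flatten [([], B.1)]) hs (flatten (monicPoly g)) q) G fun g hg => by
    obtain ⟨p, rfl⟩ := hG hg
    have hmem : ψ (flatOf n (flatten (monicPoly (code p)))) ∈ I := by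
      rw [show ψ (flatOf n (flatten (monicPoly (code p)))) = p from hcode2 p]
      exact hTI p.2
    obtain ⟨q, hq⟩ := Ideal.mem_span_range_iff_exists_fun.1 hmem
    obtain ⟨c, hc, -⟩ := exists_isComb hμ hν hs _ q hq.symm
    exact ⟨c, hc⟩
  obtain ⟨W3, hW3⟩ := List.exists_witnesses (P := fun (x : MonicCode × MonicCode) q =>
      IsComb (n + 1) (flatten [([], B.1)]) gs (sPolyCode n x.1 x.2) q ∧
        ∀ l ∈ q.2, ∀ t ∈ l.2, LexLt n (expOp (· + ·) n t.1.tail (G.getD l.1 ([], [])).1)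
          (expOp max n x.1.1 x.2.1)) (G.product G) fun x hx => by
    obtain ⟨g, h⟩ := x
    obtain ⟨hg, hh⟩ := List.mem_product.1 hx
    obtain ⟨p, rfl⟩ := hG hg
    obtain ⟨p', rfl⟩ := hG hh
    have hs' : ψ (flatOf n (sPolyCode n (code p) (code p'))) = m.sPolynomial p.1 p'.1 := by
      rw [MonomialOrder.sPolynomial, (hTmonic p p.2).leadingCoeff_eq_one,
        (hTmonic p' p'.2).leadingCoeff_eq_one, flatOf_sPolyCode, map_sub, map_mul, map_mul,
        hcode1, hcode1]
      congr 2
      · rw [map_monomial, map_one]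
      · exact hcode2 p
      · rw [map_monomial, map_one]
      · exact hcode2 p'
    -- The strict degree bound holds only for nonzero S-polynomials. For a vanishing one zero
    -- coefficients are used, whose codes have no terms to bound.
    by_cases h0 : m.sPolynomial p.1 p'.1 = 0
    · obtain ⟨c, hc, hsupp⟩ := exists_isComb hμ hν gs (sPolyCode n (code p) (code p')) 0 (by
        change ψ _ = _
        rw [hs', h0]
        simp)
      refine ⟨c, hc, fun l hl t ht => ?_⟩
      obtain ⟨j, -, hj⟩ := hsupp l hl t ht
      simp at hj
    · have hmem : ψ (flatOf n (sPolyCode n (code p) (code p'))) ∈ I := by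
        rw [hs']
        exact MonomialOrder.sPolynomial_mem_ideal (hTI p.2) (hTI p'.2)
      obtain ⟨q, hq, hdeg⟩ := hstd hmem
      obtain ⟨c, hc, hsupp⟩ := exists_isComb hμ hν gs _ q hq
      refine ⟨c, hc, fun l hl t ht => ?_⟩
      obtain ⟨j, hlj, hj⟩ := hsupp l hl t ht
      obtain ⟨r, hr, hrb⟩ := hb j
      rw [lexLt_iff, exponentOf_expOp_add, exponentOf_expOp_max, hlj,
        List.getD_eq_getElem _ _ (hgs ▸ j.2)]
      rw [List.get_eq_getElem] at hr
      rw [← hr, hcode1, hcode1, hcode1]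
      -- Division bounds each summand by the degree of the S-polynomial, which is strictly below the
      -- supremum of the two leading exponents.
      have := hdeg j _ hj
      rw [hrb, hs'] at this
      exact this.trans_lt (m.degree_sPolynomial_lt_sup_degree h0)
  -- The index is the degree of the minimal polynomial: its coefficient there is nonzero, and the
  -- bound on lengths is the weakest useful one.
  refine ⟨(G, (uniPolyOf B.1).natDegree, W1 ++ W2 ++ W3), ?_, ?_, ?_, ?_, ?_⟩
  · rw [Ne, ← ratOf_eq_zero_iff, ← uniPolyOf_coeff]
    exact Polynomial.leadingCoeff_ne_zero.2 hμ.ne_zero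
  · intro g hg t ht
    obtain ⟨p, rfl⟩ := hG hg
    exact ⟨lexLt_iff.2 (hcode3 p t ht).1, (hcode3 p t ht).2⟩
  · intro s hs'
    obtain ⟨q, hq, h⟩ := hW1 s hs'
    exact ⟨q, by simp [hq], h⟩
  · intro g hg
    obtain ⟨q, hq, h⟩ := hW2 g hg
    exact ⟨q, by simp [hq], h⟩
  · intro g hg h hh
    obtain ⟨q, hq, h⟩ := hW3 (g, h) (List.mem_product.2 ⟨hg, hh⟩)
    exact ⟨q, by simp [hq], h⟩

end Existence

/-! ### Reading off reachability from codes -/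

/-- The monomial is a product of `f` and a power of `g`. -/
def IsLinearInF (n : ℕ) (e : List ℕ) : Prop :=
  e.getD 1 0 = 1 ∧ ∀ i ∈ List.range n, i < 2 ∨ e.getD i 0 = 0

open Classical in
/-- The terms that are not products of `f` and a power of `g`. -/
noncomputable def otherTerms (n : ℕ) (q : AlgPolyCode) : AlgPolyCode :=
  q.flatMap fun t => if IsLinearInF n t.1 then [] else [t]

open Classical in
/-- Search for a polynomial that is the product of `f` and a polynomial in `g`. -/
noncomputable def checkBasis (n : ℕ) (B : BasisCode) : Bool :=
  decide (∃ q ∈ B.2, IsZeroCode (n + 1) (flatten (otherTerms n q)))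

theorem computable₂_checkBasis : Computable₂ checkBasis := by
  classical
  refine Primrec.to_comp (PrimrecPred.decide ?_)
  refine PrimrecPred.exists_mem (Primrec.snd.comp Primrec.snd) (Primrec.isZeroCode
    (Primrec.succ.comp (Primrec.fst.comp Primrec.fst)) (Primrec.flatten
      (Primrec.list_flatMap Primrec.snd (Primrec.ite ?_ (Primrec.const [])
        (Primrec.list_cons.comp Primrec.snd (Primrec.const []))))))
  have he : Primrec fun x : ((ℕ × BasisCode) × AlgPolyCode) × (List ℕ × UniPolyCode) => x.2.1 :=
    Primrec.fst.comp Primrec.snd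
  refine (Primrec.eq.comp (Primrec.list_getD_comp 0 he (Primrec.const 1))
    (Primrec.const 1)).and (PrimrecPred.forall_mem (Primrec.list_range.comp
      (Primrec.fst.comp (Primrec.fst.comp Primrec.fst))) ?_)
  exact (Primrec.nat_lt.comp Primrec.snd (Primrec.const 2)).or (Primrec.eq.comp
    (Primrec.list_getD_comp 0 (he.comp Primrec.fst) Primrec.snd) (Primrec.const 0))

theorem isLinearInF_iff {k : ℕ} {e : List ℕ} : IsLinearInF (k + 2) e ↔
    exponentOf (k + 2) e (fVar k) = 1 ∧ ∀ i : Fin k, exponentOf (k + 2) e (xVar i) = 0 := by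
  refine and_congr Iff.rfl ⟨fun h i => ?_, fun h i hi => ?_⟩
  · exact (h (i + 2) (List.mem_range.2 (by omega))).resolve_left (by omega)
  · rcases lt_or_ge i 2 with h2 | h2
    · exact .inl h2
    · obtain ⟨j, rfl⟩ := Nat.exists_eq_add_of_le' h2
      exact .inr (h ⟨j, by have := List.mem_range.1 hi; omega⟩)

open Classical in
theorem coeff_algPolyOf_otherTerms {k : ℕ} (α : QBar) (q : AlgPolyCode)
    (d : Fin (k + 2) →₀ ℕ) : (algPolyOf (k + 2) α (otherTerms (k + 2) q)).coeff d =
      if d (fVar k) = 1 ∧ ∀ i : Fin k, d (xVar i) = 0 then 0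
        else (algPolyOf (k + 2) α q).coeff d := by
  induction q with
  | nil => simp [otherTerms, algPolyOf]
  | cons t q ih =>
    rw [otherTerms] at ih
    have happ (p q : AlgPolyCode) : algPolyOf (k + 2) α (p ++ q) =
        algPolyOf (k + 2) α p + algPolyOf (k + 2) α q := by simp [algPolyOf]
    have hcons : algPolyOf (k + 2) α (t :: q) =
        algPolyOf (k + 2) α [t] + algPolyOf (k + 2) α q := happ [t] q
    rw [otherTerms, List.flatMap_cons, happ, coeff_add, ih, hcons, coeff_add]
    have hone : (algPolyOf (k + 2) α [t]).coeff d = if exponentOf (k + 2) t.1 = d then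
        Polynomial.aeval α (uniPolyOf t.2) else 0 := by
      simp [algPolyOf, coeff_monomial]
    have hnil : (algPolyOf (k + 2) α []).coeff d = 0 := by simp [algPolyOf]
    by_cases ht : IsLinearInF (k + 2) t.1
    · rw [if_pos ht, hnil, zero_add]
      split_ifs with hd
      · rfl
      · rw [hone, if_neg, zero_add]
        rintro rfl
        exact hd (isLinearInF_iff.1 ht)
    · rw [if_neg ht]
      split_ifs with hd
      · rw [hone, if_neg, zero_add]
        rintro rfl
        exact ht (isLinearInF_iff.2 hd)
      · rfl

theorem support_C_mul_hitPoly {k N : ℕ} (a : QBar) {d : Fin (k + 2) →₀ ℕ}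
    (hd : d ∈ (C a * hitPoly k N).support) : d (fVar k) = 1 ∧ ∀ i : Fin k, d (xVar i) = 0 := by
  classical
  have hP : (∏ j ∈ Finset.range N, (X (gVar k) - C (j : QBar))) ∈
      supported QBar {gVar k} :=
    Subalgebra.prod_mem _ fun j _ =>
      Subalgebra.sub_mem _ (X_mem_supported.2 rfl) (Subalgebra.algebraMap_mem _ (j : QBar))
  have hd' : d ∈ (X (fVar k) * ∏ j ∈ Finset.range N, (X (gVar k) - C (j : QBar))).support := by
    rw [mem_support_iff, coeff_C_mul] at hd
    exact mem_support_iff.2 (right_ne_zero_of_mul hd)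
  rw [support_X_mul, Finset.mem_map] at hd'
  obtain ⟨e, he, rfl⟩ := hd'
  have h0 (i : Fin (k + 2)) (hi : i ≠ gVar k) : e i = 0 := by
    by_contra hne
    exact hi (mem_supported.1 hP ((mem_vars_iff_mem_support i).2 ⟨e, he, Finsupp.mem_support_iff.2 hne⟩))
  have hxf (i : Fin k) : xVar i ≠ fVar k := fun h =>
    Fin.succ_ne_zero i (Fin.succ_injective _ h)
  refine ⟨?_, fun i => ?_⟩
  · simp [h0 (fVar k) (Fin.succ_ne_zero (0 : Fin (k + 1)))]
  · simp [h0 (xVar i) (Fin.succ_ne_zero _), (hxf i).symm]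

/-- Basis elements are monic, hence nonzero, so an element that passes the test proves positivity.
Conversely, the multiple of some `P_N` in the basis passes it. -/
theorem P2PInstance.checkBasis_iff {k : ℕ} (A : P2PInstance k) {B : BasisCode}
    {c : GroebnerCert} (hc : c.Valid (k + 2) B) (hμ : Irreducible (uniPolyOf B.1)) {α : QBar}
    (hα : Polynomial.aeval α (uniPolyOf B.1) = 0)
    (hI : Ideal.span {p | ∃ q ∈ B.2, algPolyOf (k + 2) α q = p} = A.toLoop.invariantIdeal) :
    checkBasis (k + 2) (c.basis B) = true ↔ A.Positive := by
  classical
  have hG := hI ▸ GroebnerCert.isGroebnerBasis hc hα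
  rw [checkBasis, decide_eq_true_iff]
  constructor
  · rintro ⟨q, hq, hzero⟩
    have hmem : algPolyOf (k + 2) α q ∈ A.toLoop.invariantIdeal :=
      hG.2.1 ▸ Ideal.subset_span ⟨q, hq, rfl⟩
    obtain ⟨g, hg, rfl⟩ := List.mem_map.1 hq
    refine A.positive_of_mem_invariantIdeal hmem (hc.monic α hg).1.ne_zero fun d hd => ?_
    by_contra hne
    have h := coeff_algPolyOf_otherTerms α (monicPoly g) d
    rw [if_neg hne, algPolyOf_eq_map, isZeroCode_iff.1 hzero, map_zero, coeff_zero] at h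
    exact mem_support_iff.1 hd h.symm
  · intro hpos
    obtain ⟨N, a, -, q, hq, heq⟩ := (A.positive_iff_groebner
      (ord := (inferInstance : LinearOrder (Fin (k + 2))))
      (Fin.mk_lt_mk.2 Nat.zero_lt_one) (fun i => Fin.succ_lt_succ_iff.2 (Fin.succ_pos i)) hG).1 hpos
    -- The other terms of this element sum to zero at `α`. Because coefficients have degree below
    -- that of the minimal polynomial, they cancel formally as well, which is what the test sees.
    refine ⟨q, hq, isZeroCode_iff.2 (flatOf_flatten_eq_zero hμ hα (fun t ht => ?_) ?_)⟩
    · obtain ⟨s, hs, ht⟩ := List.mem_flatMap.1 ht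
      split_ifs at ht
      · simp at ht
      · exact hc.degree_lt hμ hq t (List.mem_singleton.1 ht ▸ hs)
    · ext d
      rw [coeff_algPolyOf_otherTerms, coeff_zero]
      split_ifs with hd
      · rfl
      · by_contra hne
        rw [heq] at hne
        exact hd (support_C_mul_hitPoly a (mem_support_iff.2 hne))

/-! ### The loop of an instance is computable -/

theorem List.sum_map_range {M : Type*} [AddCommMonoid M] (k : ℕ) (f : ℕ → M) :
    ((List.range k).map f).sum = ∑ i : Fin k, f i := by
  rw [← List.map_coe_finRange_eq_range, List.map_map, ← List.ofFn_eq_map, List.sum_ofFn]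
  rfl

@[simp] theorem polyOf_nil (n : ℕ) : polyOf n [] = 0 := rfl

@[simp] theorem polyOf_cons (n : ℕ) (t : List ℕ × RatCode) (p : PolyCode) :
    polyOf n (t :: p) = monomial (exponentOf n t.1) (ratOf t.2) + polyOf n p := by
  simp [polyOf]

theorem polyOf_flatMap (n : ℕ) {β : Type*} (l : List β) (f : β → PolyCode) :
    polyOf n (l.flatMap f) = (l.map fun b => polyOf n (f b)).sum := by
  induction l with
  | nil => rfl
  | cons b l ih =>
    rw [List.map_cons, List.sum_cons, ← ih, List.flatMap_cons]
    simp [polyOf]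

/-- The exponents of the `a`-th power of variable `i`. -/
def unitExp (i a : ℕ) : List ℕ := (List.range i).map (fun _ => 0) ++ [a]

theorem getD_unitExp (i a j : ℕ) : (unitExp i a).getD j 0 = if j = i then a else 0 := by
  rw [unitExp, List.getD_eq_getElem?_getD]
  rcases lt_trichotomy j i with h | rfl | h
  · rw [List.getElem?_append_left (by simpa using h)]
    simp [h, h.ne]
  · simp
  · rw [List.getElem?_eq_none (by simp; omega), if_neg h.ne']
    rfl

theorem Primrec.unitExp {α : Type*} [Primcodable α] {i a : α → ℕ} (hi : Primrec i)
    (ha : Primrec a) : Primrec fun x => unitExp (i x) (a x) :=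
  Primrec.list_append.comp (Primrec.list_map (Primrec.list_range.comp hi) (Primrec₂.const 0))
    (Primrec.list_cons.comp ha (Primrec.const []))

theorem exponentOf_unitExp {n : ℕ} (i : Fin n) (a : ℕ) :
    exponentOf n (unitExp i a) = Finsupp.single i a := by
  ext j
  rw [exponentOf_apply, getD_unitExp, Finsupp.single_apply]
  simp only [Fin.ext_iff, eq_comm]

theorem exponentOf_nil (n : ℕ) : exponentOf n [] = 0 := by
  ext i
  simp [exponentOf_apply]

theorem xVar_injective {k : ℕ} : Function.Injective (xVar (k := k)) :=
  (Fin.succ_injective _).comp (Fin.succ_injective _)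

theorem exponentOf_cons_cons (k a b : ℕ) (e : List ℕ) : exponentOf (k + 2) (a :: b :: e) =
    Finsupp.single (gVar k) a + Finsupp.single (fVar k) b +
      Finsupp.mapDomain xVar (exponentOf k e) := by
  have hfg : fVar k ≠ gVar k := Fin.succ_ne_zero (0 : Fin (k + 1))
  have hxg (i : Fin k) : xVar i ≠ gVar k := Fin.succ_ne_zero _
  have hxf (i : Fin k) : xVar i ≠ fVar k := fun h =>
    Fin.succ_ne_zero i (Fin.succ_injective _ h)
  ext i
  revert i
  rw [Fin.forall_variables]
  refine ⟨?_, ?_, fun i => ?_⟩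
  · rw [Finsupp.add_apply, Finsupp.mapDomain_of_notMem_range _ _ (by rintro ⟨i, h⟩; exact hxg i h),
      Finsupp.add_apply, Finsupp.single_eq_same, Finsupp.single_eq_of_ne hfg.symm]
    rfl
  · rw [Finsupp.add_apply, Finsupp.mapDomain_of_notMem_range _ _ (by rintro ⟨i, h⟩; exact hxf i h),
      Finsupp.add_apply, Finsupp.single_eq_same, Finsupp.single_eq_of_ne hfg, zero_add]
    rfl
  · rw [Finsupp.add_apply, Finsupp.mapDomain_apply xVar_injective, Finsupp.add_apply,
      Finsupp.single_eq_of_ne (hxg i), Finsupp.single_eq_of_ne (hxf i), zero_add, zero_add]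
    rfl

theorem polyOf_shift (k : ℕ) (p : PolyCode) :
    polyOf (k + 2) (p.map fun t => (0 :: 0 :: t.1, t.2)) = rename xVar (polyOf k p) := by
  induction p with
  | nil => simp
  | cons t p ih =>
    rw [List.map_cons, polyOf_cons, ih, polyOf_cons, map_add, rename_monomial,
      exponentOf_cons_cons, Finsupp.single_zero, Finsupp.single_zero, add_zero, zero_add]

/-- The code of the term `f * (x_i - t) ^ 2`. -/
def squareCode (i : ℕ) (t : RatCode) : PolyCode :=
  [(0 :: 1 :: unitExp i 2, (1, 0)), (0 :: 1 :: unitExp i 1, ratMul (-2, 0) t),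
    ([0, 1], ratMul t t)]

theorem polyOf_squareCode {k : ℕ} (i : Fin k) (t : RatCode) : polyOf (k + 2) (squareCode i t) =
    X (fVar k) * (X (xVar i) - C (ratOf t)) ^ 2 := by
  have h (a : ℕ) : exponentOf (k + 2) (0 :: 1 :: unitExp i a) =
      Finsupp.single (fVar k) 1 + Finsupp.single (xVar i) a := by
    rw [exponentOf_cons_cons, exponentOf_unitExp, Finsupp.mapDomain_single, Finsupp.single_zero,
      zero_add]
  have h0 : exponentOf (k + 2) [0, 1] = Finsupp.single (fVar k) 1 := by
    rw [exponentOf_cons_cons, exponentOf_nil, Finsupp.mapDomain_zero, Finsupp.single_zero,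
      zero_add, add_zero]
  have hm (a : ℕ) (r : ℚ) : monomial (Finsupp.single (fVar k) 1 + Finsupp.single (xVar i) a) r =
      X (fVar k) * (X (xVar i) ^ a * C r) := by
    rw [X_pow_eq_monomial, X, mul_comm _ (C r), C_mul_monomial, monomial_mul, mul_one, one_mul]
  have hm0 (r : ℚ) : monomial (Finsupp.single (fVar k) 1) r = X (fVar k) * C r := by
    rw [mul_comm, X, C_mul_monomial, mul_one]
  have h2 : ratOf (-2, 0) = -2 := by simp [ratOf]
  rw [squareCode, polyOf_cons, polyOf_cons, polyOf_cons, polyOf_nil, h, h, h0, hm, hm, hm0,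
    ratOf_ratMul, ratOf_ratMul, ratOf_one, h2]
  simp only [map_mul, map_neg, map_one, map_ofNat]
  ring

/-- The code of the loop of an instance. -/
def mkLoop (c : P2PCode) : List (PolyCode × PolyCode) :=
  ([], [([1], (1, 0)), ([], (1, 0))]) ::
    ([([], (1, 0))], (List.range c.1).flatMap fun i =>
      squareCode i (c.2.getD i ([], (0, 0), (0, 0))).2.2) ::
    (List.range c.1).map fun i => ([([], (c.2.getD i ([], (0, 0), (0, 0))).2.1)],
      (c.2.getD i ([], (0, 0), (0, 0))).1.map fun t => (0 :: 0 :: t.1, t.2))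

theorem loopOf_mkLoop (c : P2PCode) : loopOf (c.1 + 2, mkLoop c) = (p2pOf c).toLoop := by
  have hmon (r : ℚ) : (monomial (exponentOf (c.1 + 2) []) r : MvPolynomial (Fin (c.1 + 2)) ℚ) =
      C r := by
    rw [exponentOf_nil, C_apply]
  have hx (i : Fin c.1) : (mkLoop c).getD (xVar i) ([], []) =
      ([([], (c.2.getD i ([], (0, 0), (0, 0))).2.1)],
        (c.2.getD i ([], (0, 0), (0, 0))).1.map fun t => (0 :: 0 :: t.1, t.2)) := by
    simp [mkLoop, xVar]
  rw [loopOf, P2PInstance.toLoop, PolyLoop.mk.injEq]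
  constructor
  · funext i
    revert i
    rw [Fin.forall_variables]
    refine ⟨?_, ?_, fun i => ?_⟩
    · change polyOf (c.1 + 2) [] = C 0
      simp
    · change polyOf (c.1 + 2) [([], (1, 0))] = C 1
      simp [hmon]
    · change polyOf (c.1 + 2) ((mkLoop c).getD (xVar i) ([], [])).1 = C ((p2pOf c).init i)
      rw [hx, polyOf_cons, polyOf_nil, hmon, add_zero]
      rfl
  · funext i
    revert i
    rw [Fin.forall_variables]
    refine ⟨?_, ?_, fun i => ?_⟩
    · change polyOf (c.1 + 2) [([1], (1, 0)), ([], (1, 0))] = X (gVar c.1) + 1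
      have h1 : exponentOf (c.1 + 2) [1] = Finsupp.single (gVar c.1) 1 :=
        exponentOf_unitExp (gVar c.1) 1
      rw [polyOf_cons, polyOf_cons, polyOf_nil, hmon, h1, ratOf_one, add_zero, C_1]
      rfl
    · change polyOf (c.1 + 2) ((List.range c.1).flatMap fun i =>
        squareCode i (c.2.getD i ([], (0, 0), (0, 0))).2.2) =
          X (fVar c.1) * ∑ i : Fin c.1, (X (xVar i) - C ((p2pOf c).target i)) ^ 2
      rw [polyOf_flatMap, List.sum_map_range, Finset.mul_sum]
      exact Finset.sum_congr rfl fun i _ => polyOf_squareCode i _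
    · change polyOf (c.1 + 2) ((mkLoop c).getD (xVar i) ([], [])).2 = rename xVar ((p2pOf c).p i)
      rw [hx, polyOf_shift]
      rfl

theorem primrec_mkLoop : Primrec mkLoop := by
  have hentry : Primrec fun x : P2PCode × ℕ => x.1.2.getD x.2 ([], (0, 0), (0, 0)) :=
    Primrec.list_getD_comp _ (Primrec.snd.comp Primrec.fst) Primrec.snd
  have hrange : Primrec fun c : P2PCode => List.range c.1 := Primrec.list_range.comp Primrec.fst
  have htarget := Primrec.snd.comp (Primrec.snd.comp hentry)
  refine Primrec.list_cons.comp (Primrec.const _) (Primrec.list_cons.comp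
    ((Primrec.const _).pair (Primrec.list_flatMap hrange ?_)) (Primrec.list_map hrange ?_))
  · have hunit (a : ℕ) : Primrec fun x : P2PCode × ℕ => 0 :: 1 :: unitExp x.2 a :=
      Primrec.list_cons.comp (Primrec.const 0) (Primrec.list_cons.comp (Primrec.const 1)
        (Primrec.unitExp Primrec.snd (Primrec.const a)))
    exact Primrec.list_cons.comp ((hunit 2).pair (Primrec.const (1, 0)))
      (Primrec.list_cons.comp
        ((hunit 1).pair (primrec_ratMul.comp (Primrec.const (-2, 0)) htarget))
        (Primrec.list_cons.comp
          ((Primrec.const [0, 1]).pair (primrec_ratMul.comp htarget htarget)) (Primrec.const [])))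
  · refine Primrec.pair (Primrec.list_cons.comp ((Primrec.const []).pair
      (Primrec.fst.comp (Primrec.snd.comp hentry))) (Primrec.const []))
      (Primrec.list_map (Primrec.fst.comp hentry) (Primrec.pair
        (Primrec.list_cons.comp (Primrec.const 0) (Primrec.list_cons.comp (Primrec.const 0)
          (Primrec.fst.comp Primrec.snd))) (Primrec.snd.comp Primrec.snd)))

/-! ### Reduction of the Skolem problem to point-to-point reachability -/

/-- The instance `x_i ← x_0 * x_{i+1}`, `x_{k-1} ← x_0 * ∑ i, a_i * x_i` with target `0`. -/
def skolemToP2P (c : SkolemCode) : P2PCode :=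
  (c.1, (List.range c.1).map fun i =>
    (if i + 1 < c.1 then [(expOp (· + ·) c.1 (unitExp 0 1) (unitExp (i + 1) 1), (1, 0))]
      else (List.range c.1).map fun j => (expOp (· + ·) c.1 (unitExp 0 1) (unitExp j 1),
        (c.2.getD j ((0, 0), (0, 0))).1),
      (c.2.getD i ((0, 0), (0, 0))).2, (0, 0)))

theorem primrec_skolemToP2P : Primrec skolemToP2P := by
  have hrange : Primrec fun c : SkolemCode => List.range c.1 := Primrec.list_range.comp Primrec.fst
  refine Primrec.fst.pair (Primrec.list_map hrange (Primrec.pair (Primrec.ite ?_ ?_ ?_)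
    (Primrec.pair ?_ (Primrec.const (0, 0)))))
  · exact Primrec.nat_lt.comp (Primrec.succ.comp Primrec.snd) (Primrec.fst.comp Primrec.fst)
  · exact Primrec.list_cons.comp ((Primrec.expOp Primrec.nat_add (Primrec.fst.comp Primrec.fst)
      (Primrec.const _) (Primrec.unitExp (Primrec.succ.comp Primrec.snd) (Primrec.const 1))).pair
        (Primrec.const (1, 0))) (Primrec.const [])
  · exact Primrec.list_map (hrange.comp Primrec.fst) ((Primrec.expOp Primrec.nat_add
      (Primrec.fst.comp (Primrec.fst.comp Primrec.fst)) (Primrec.const _)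
      (Primrec.unitExp Primrec.snd (Primrec.const 1))).pair (Primrec.fst.comp
        (Primrec.list_getD_comp _ (Primrec.snd.comp (Primrec.fst.comp Primrec.fst)) Primrec.snd)))
  · exact Primrec.snd.comp
      (Primrec.list_getD_comp _ (Primrec.snd.comp Primrec.fst) Primrec.snd)

theorem polyOf_map_range (n k : ℕ) (e : ℕ → List ℕ) (r : ℕ → RatCode) :
    polyOf n ((List.range k).map fun j => (e j, r j)) =
      ∑ j : Fin k, monomial (exponentOf n (e j)) (ratOf (r j)) := by
  rw [← List.sum_map_range k fun j => monomial (exponentOf n (e j)) (ratOf (r j)), polyOf,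
    List.map_map]
  rfl

/-- The factor by which the `n`-th vector of the instance differs from that of the recurrence. -/
noncomputable def skolemFactor (u : ℕ → ℚ) : ℕ → ℚ
  | 0 => 1
  | n + 1 => skolemFactor u n ^ 2 * u n

theorem exists_eq_zero_of_skolemFactor_eq_zero {u : ℕ → ℚ} {n : ℕ} (h : skolemFactor u n = 0) :
    ∃ m, u m = 0 := by
  induction n with
  | zero => exact absurd h one_ne_zero
  | succ n ih =>
    rcases mul_eq_zero.1 h with h | h
    · exact ih (pow_eq_zero_iff two_ne_zero |>.1 h)
    · exact ⟨n, h⟩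

/-- Let `s` be the factor at time `n`. The vector carries `s`, and multiplication by its entry `x_0
= s * u(n)` contributes a second `s` and `u(n)`; the remaining operation is the shift of the
recurrence. -/
theorem seq_skolemToP2P (c : SkolemCode) (n : ℕ) (i : Fin c.1) :
    (p2pOf (skolemToP2P c)).seq n i = skolemFactor (lrsOf c) n * lrsOf c (n + i) := by
  have hentry (i : Fin c.1) : (skolemToP2P c).2.getD i ([], (0, 0), (0, 0)) =
      (if (i : ℕ) + 1 < c.1 then
          [(expOp (· + ·) c.1 (unitExp 0 1) (unitExp (i + 1) 1), (1, 0))]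
        else (List.range c.1).map fun j => (expOp (· + ·) c.1 (unitExp 0 1) (unitExp j 1),
          (c.2.getD j ((0, 0), (0, 0))).1),
        (c.2.getD i ((0, 0), (0, 0))).2, (0, 0)) := by
    simp [skolemToP2P]
  have hmon (v : Fin c.1 → ℚ) (j : Fin c.1) (r : ℚ) : eval v (monomial (exponentOf c.1
      (expOp (· + ·) c.1 (unitExp 0 1) (unitExp j 1))) r) =
        v ⟨0, Nat.zero_lt_of_lt j.2⟩ * (r * v j) := by
    rw [exponentOf_expOp_add, exponentOf_unitExp j,
      exponentOf_unitExp (⟨0, Nat.zero_lt_of_lt j.2⟩ : Fin c.1)]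
    have : monomial (Finsupp.single (⟨0, Nat.zero_lt_of_lt j.2⟩ : Fin c.1) 1 +
        Finsupp.single j 1) r = X ⟨0, Nat.zero_lt_of_lt j.2⟩ * (C r * X j) := by
      rw [X, X, C_mul_monomial, monomial_mul, one_mul, mul_one]
    rw [this]
    simp
  induction n generalizing i with
  | zero =>
    have h : lrsOf c i = ratOf (c.2.getD i ((0, 0), (0, 0))).2 :=
      (recurrenceOf c).mkSol_eq_init _ i
    rw [zero_add, h, skolemFactor, one_mul]
    change ratOf ((skolemToP2P c).2.getD i ([], (0, 0), (0, 0))).2.1 = _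
    rw [hentry]
  | succ n ih =>
    have hpos : 0 < c.1 := Nat.zero_lt_of_lt i.2
    obtain ⟨v, hv⟩ : ∃ v : Fin c.1 → ℚ, v = (p2pOf (skolemToP2P c)).seq n := ⟨_, rfl⟩
    have ih' (j : Fin c.1) : v j = skolemFactor (lrsOf c) n * lrsOf c (n + j) := hv ▸ ih j
    have hstep : (p2pOf (skolemToP2P c)).seq (n + 1) i =
        eval v (polyOf c.1 ((skolemToP2P c).2.getD i ([], (0, 0), (0, 0))).1) := by
      subst hv
      rfl
    refine hstep.trans ?_
    rw [hentry]
    split_ifs with hi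
    · rw [polyOf_cons, polyOf_nil, add_zero, hmon v ⟨i + 1, hi⟩, ih', ih', skolemFactor, ratOf_one,
        show n + 1 + (i : ℕ) = n + (i + 1) by omega]
      simp only [add_zero]
      ring
    -- Here `i` is the last index, whose successor value comes from the recurrence itself.
    · have hik : n + 1 + (i : ℕ) = n + c.1 := by have := i.2; omega
      have hrec : lrsOf c (n + c.1) = ∑ j : Fin c.1,
          ratOf (c.2.getD j ((0, 0), (0, 0))).1 * lrsOf c (n + j) :=
        (recurrenceOf c).is_sol_mkSol _ n
      rw [polyOf_map_range, map_sum, hik, hrec, skolemFactor, Finset.mul_sum]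
      refine Finset.sum_congr rfl fun j _ => ?_
      rw [hmon, ih', ih']
      simp only [add_zero]
      ring

/-- A zero at time `m` makes the common factor, and thus the whole vector, vanish at `m + 1`.
Conversely, if entry `0` vanishes, then either the sequence vanishes now or the factor does, and the
factor is a product of earlier values. The conditions on order and trailing coefficient are split
off in decidable form. -/
theorem skolem_iff (c : SkolemCode) : Skolem c ↔
    (0 < c.1 ∧ ¬ (c.2.getD 0 ((0, 0), (0, 0))).1.1 = 0) ∧ P2P (skolemToP2P c) := by
  have htarget (i : Fin c.1) : (p2pOf (skolemToP2P c)).target i = 0 := by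
    change ratOf ((skolemToP2P c).2.getD i ([], (0, 0), (0, 0))).2.2 = 0
    simp [skolemToP2P]
  have hcond : (∃ h : 0 < c.1, (recurrenceOf c).coeffs ⟨0, h⟩ ≠ 0) ↔
      0 < c.1 ∧ ¬ (c.2.getD 0 ((0, 0), (0, 0))).1.1 = 0 := by
    rw [← ratOf_eq_zero_iff]
    exact ⟨fun ⟨h, h'⟩ => ⟨h, h'⟩, fun ⟨h, h'⟩ => ⟨h, h'⟩⟩
  rw [Skolem, hcond]
  refine and_congr_right fun ⟨hpos, _⟩ => ?_
  constructor
  · rintro ⟨m, hm⟩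
    refine ⟨m + 1, fun i => ?_⟩
    refine (seq_skolemToP2P c (m + 1) i).trans (Eq.trans ?_ (htarget i).symm)
    rw [skolemFactor, hm, mul_zero, zero_mul]
  · rintro ⟨m, hm⟩
    have h0 := (seq_skolemToP2P c m ⟨0, hpos⟩).symm.trans
      ((hm ⟨0, hpos⟩).trans (htarget ⟨0, hpos⟩))
    rcases mul_eq_zero.1 h0 with h0 | h0
    · exact exists_eq_zero_of_skolemFactor_eq_zero h0
    · exact ⟨_, h0⟩

/-! ### The decision procedure -/

/-- The computed basis keeps the minimal polynomial of the given one, so the same root `α`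
represents both. -/
theorem exists_groebnerSearch_spec (c : P2PCode) {B : BasisCode}
    (hB : SPInv (c.1 + 2, mkLoop c) B) :
    ∃ B' ∈ groebnerSearch (c.1 + 2) B, (∃ G : Set (MvPolynomial (Fin (c.1 + 2)) QBar),
      Represents (c.1 + 2) B' G ∧
      IsGroebnerBasis (lexOrder (inferInstance : LinearOrder (Fin (c.1 + 2))))
        (p2pOf c).toLoop.invariantIdeal G) ∧
      (checkBasis (c.1 + 2) B' = true ↔ P2P c) := by
  obtain ⟨S, ⟨hμ, α, hα, rfl⟩, hspan⟩ := hB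
  rw [loopOf_mkLoop] at hspan
  obtain ⟨cert, hcert, hmem⟩ := exists_mem_groebnerSearch
    (GroebnerCert.exists_valid (c.1 + 2) hμ)
  refine ⟨_, hmem, ⟨_, ⟨hμ, α, hα, rfl⟩, ?_⟩,
    (p2pOf c).checkBasis_iff hcert hμ hα hspan⟩
  rw [← hspan]
  exact GroebnerCert.isGroebnerBasis hcert hα

theorem p2p_turingReduces_spInv : TuringReduces P2P SPInv := by
  refine TuringReduces.of_one_call (fun c => (c.1 + 2, mkLoop c))
    (((Primrec.succ.comp (Primrec.succ.comp Primrec.fst)).pair primrec_mkLoop).to_comp)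
    (fun x => (groebnerSearch (x.1.1 + 2) x.2).map (checkBasis (x.1.1 + 2))) ?_ ?_
  · have hn : Computable fun x : P2PCode × BasisCode => x.1.1 + 2 :=
      (Primrec.succ.comp (Primrec.succ.comp (Primrec.fst.comp Primrec.fst))).to_comp
    exact (partrec₂_groebnerSearch.comp hn Computable.snd).map
      (computable₂_checkBasis.comp (hn.comp Computable.fst) Computable.snd)
  · intro c B hB
    obtain ⟨B', hB', -, h⟩ := exists_groebnerSearch_spec c hB
    exact ⟨_, Part.mem_map _ hB', h⟩

/-- A single oracle call suffices: the instance is translated first, and the side conditions are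
tested on the original instance together with the answer. -/
theorem skolem_turingReduces_spInv : TuringReduces Skolem SPInv := by
  classical
  refine TuringReduces.of_one_call (fun c => (c.1 + 2, mkLoop (skolemToP2P c)))
    (((Primrec.succ.comp (Primrec.succ.comp Primrec.fst)).pair
      (primrec_mkLoop.comp primrec_skolemToP2P)).to_comp)
    (fun x => (groebnerSearch (x.1.1 + 2) x.2).map fun B' =>
      decide (0 < x.1.1 ∧ ¬ (x.1.2.getD 0 ((0, 0), (0, 0))).1.1 = 0) &&
        checkBasis (x.1.1 + 2) B') ?_ ?_
  · have hn : Computable fun x : SkolemCode × BasisCode => x.1.1 + 2 :=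
      (Primrec.succ.comp (Primrec.succ.comp (Primrec.fst.comp Primrec.fst))).to_comp
    have hcond : PrimrecPred fun x : SkolemCode × BasisCode =>
        0 < x.1.1 ∧ ¬ (x.1.2.getD 0 ((0, 0), (0, 0))).1.1 = 0 :=
      (Primrec.nat_lt.comp (Primrec.const 0) (Primrec.fst.comp Primrec.fst)).and
        (Primrec.eq.comp (Primrec.fst.comp (Primrec.fst.comp (Primrec.list_getD_comp _
          (Primrec.snd.comp Primrec.fst) (Primrec.const 0)))) (Primrec.const 0)).not
    exact (partrec₂_groebnerSearch.comp hn Computable.snd).map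
      (Primrec.and.to_comp.comp (hcond.decide.to_comp.comp Computable.fst)
        (computable₂_checkBasis.comp (hn.comp Computable.fst) Computable.snd))
  · intro c B hB
    obtain ⟨B', hB', -, h⟩ := exists_groebnerSearch_spec (skolemToP2P c) hB
    refine ⟨_, Part.mem_map _ hB', ?_⟩
    rw [Bool.and_eq_true, decide_eq_true_iff, skolem_iff]
    exact and_congr_right fun _ => h

theorem theorem2 :
    -- point-to-point reachability Turing-reduces to the strongest polynomial invariant problem
    TuringReduces P2P SPInv ∧
    -- reading off reachability from a Gröbner basis of the invariant ideal of the loop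
    (∀ (k : ℕ) (A : P2PInstance k) (ord : LinearOrder (Fin (k + 2))),
      ord.lt (gVar k) (fVar k) → (∀ i : Fin k, ord.lt (fVar k) (xVar i)) →
      ∀ G : Set (MvPolynomial (Fin (k + 2)) QBar),
        (IsGroebnerBasis (lexOrder ord) A.toLoop.invariantIdeal G →
          (A.Positive ↔ ∃ (N : ℕ) (a : QBar), a ≠ 0 ∧ C a * hitPoly k N ∈ G)) ∧
        (IsReducedGroebnerBasis (lexOrder ord) A.toLoop.invariantIdeal G →
          (A.Positive ↔ ∃ N : ℕ, hitPoly k N ∈ G))) ∧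
    -- the resulting decision procedure: construct the loop, transform any basis of its invariant
    -- ideal into a lexicographic Gröbner basis, search that basis
    (∃ (mkLoop : P2PCode → List (PolyCode × PolyCode)) (groebner : ℕ → BasisCode →. BasisCode)
        (check : ℕ → BasisCode → Bool),
      Computable mkLoop ∧ Partrec₂ groebner ∧ Computable₂ check ∧
      ∀ c : P2PCode, loopOf (c.1 + 2, mkLoop c) = (p2pOf c).toLoop ∧
        ∀ B : BasisCode, SPInv (c.1 + 2, mkLoop c) B →
          ∃ B' ∈ groebner (c.1 + 2) B, ∃ G : Set (MvPolynomial (Fin (c.1 + 2)) QBar),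
            Represents (c.1 + 2) B' G ∧
            IsGroebnerBasis (lexOrder (inferInstance : LinearOrder (Fin (c.1 + 2))))
              (p2pOf c).toLoop.invariantIdeal G ∧
            (check (c.1 + 2) B' = true ↔
              ∃ (N : ℕ) (a : QBar), a ≠ 0 ∧ C a * hitPoly c.1 N ∈ G) ∧
            (check (c.1 + 2) B' = true ↔ P2P c)) ∧
    -- hence the strongest polynomial invariant problem is Skolem-hard
    TuringReduces Skolem SPInv := by
  refine ⟨p2p_turingReduces_spInv, fun k A ord hgf hfx G => ⟨A.positive_iff_groebner hgf hfx,
    A.positive_iff_reduced_groebner hgf hfx⟩, ⟨mkLoop, groebnerSearch, checkBasis,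
    primrec_mkLoop.to_comp, partrec₂_groebnerSearch, computable₂_checkBasis,
    fun c => ⟨loopOf_mkLoop c, fun B hB => ?_⟩⟩, skolem_turingReduces_spInv⟩
  obtain ⟨B', hB', ⟨G, hrep, hG⟩, hcheck⟩ := exists_groebnerSearch_spec c hB
  refine ⟨B', hB', G, hrep, hG, hcheck.trans ?_, hcheck⟩
  exact (p2pOf c).positive_iff_groebner (Fin.mk_lt_mk.2 Nat.zero_lt_one)
    (fun i => Fin.succ_lt_succ_iff.2 (Fin.succ_pos i)) hG
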